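/- Let $M$ be a smooth ($C^\infty$, Hausdorff, without boundary) manifold of dimension $n$ with a pseudo-Riemannian metric $\mathbf g$ and Levi-Civita connection $\nabla$, let $\hbar\neq 0$ be real, and let all functions and tensor fields be smooth. Let $H=\frac12 g^{ab}p_ap_b+V$ be a natural Hamiltonian on $T^*M$ with $k$ quadratic first integrals $K^{(i)}=\frac12 K^{(i)\,ab}p_ap_b+V^{(i)}$, i.e. $\{H,K^{(i)}\}=0$, where $\mathbf K^{(i)}=(K^{(i)\,ab})$ is a symmetric contravariant two-tensor, $i=1,\dots,k$. For functions $E,F$ put $$\widehat H_E=-\tfrac{\hbar^2}{2}\bigl(\nabla_a g^{ab}\nabla_b+E\bigr)+V,\qquad \widehat K^{(i)}_F=-\tfrac{\hbar^2}{2}\bigl(\nabla_aK^{(i)\,ab}\nabla_b+F\bigr)+V^{(i)},$$ operators acting on smooth functions, and let $\mathbf K^{(i)}\nabla E$ denote the one-form with components $g_{ab}K^{(i)\,bc}\partial_cE$. Assume that for each $i$ there are functions $E^{(i)},F^{(i)}$ on $M$ (quantum corrections) with $$[\widehat H_{E^{(i)}},\widehat K^{(i)}_{F^{(i)}}]=0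 .$$ Let $E$ be a function on $M$. Then the following hold. 1. $E$ is locally a simultaneous quantum correction of $H$ for all the $K^{(i)}$ (that is, every point of $M$ has an open neighbourhood $U$ with functions $W^{(1)},\dots,W^{(k)}$ on $U$ such that $[\widehat H_E,\widehat K^{(i)}_{W^{(i)}}]=0$ on $U$ for every $i$) if and only if $$d(\mathbf K^{(i)}\nabla E^{(i)})=d(\mathbf K^{(i)}\nabla E),\qquad i=1,\dots,k.$$ If $M$ is simply connected, the same condition is necessary and sufficient for the existence of functions $W^{(1)},\dots,W^{(k)}$ on all of $M$ with $[\widehat H_E,\widehat K^{(i)}_{W^{(i)}}]=0$ for every $i$. 2. Under this condition the one-forms $\mathbf K^{(i)}\nabla(E-E^{(i)})$ are closed. For every open $U\subseteq M$, every $i$ and every function $W$ on $U$, one has $[\widehat H_E,\widehat K^{(i)}_{W}]=0$ on $U$ if and only if $W=F^{(i)}+\bar F^{(i)}$ on $U$, where $\bar F^{(i)}$ is a potential on $U$ of $\mathbf K^{(i)}\nabla(E-E^{(i)})$, i.e. $d\bar F^{(i)}=\mathbf K^{(i)}\nabla(E-E^{(i)})$. -/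

import Mathlib

open scoped ContDiff Manifold

noncomputable section

namespace MLB

/-- The inverse `φ⁻¹ : ℝⁿ → M` of the preferred chart `φ` of `M` at the point `c`
(meaningful on `φ.target`). -/
def chartInv {n : ℕ} {M : Type*} [TopologicalSpace M] [ChartedSpace (EuclideanSpace ℝ (Fin n)) M]
    (c : M) (y : EuclideanSpace ℝ (Fin n)) : M :=
  (extChartAt (𝓡 n) c).symm y

/-- The open subset of `ℝⁿ` on which the coordinates given by the chart at `c` take their values. -/
def chartDom {n : ℕ} {M : Type*} [TopologicalSpace M] [ChartedSpace (EuclideanSpace ℝ (Fin n)) M]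
    (c : M) : Set (EuclideanSpace ℝ (Fin n)) :=
  (extChartAt (𝓡 n) c).target

/-- The coordinate vector `∂/∂q^a` of the chart at `c`, at the point with coordinates `y`. -/
def frame {n : ℕ} {M : Type*} [TopologicalSpace M] [ChartedSpace (EuclideanSpace ℝ (Fin n)) M]
    (c : M) (y : EuclideanSpace ℝ (Fin n)) (a : Fin n) :
    TangentSpace (𝓡 n) (chartInv c y) :=
  mfderiv 𝓘(ℝ, EuclideanSpace ℝ (Fin n)) (𝓡 n) (chartInv (n := n) c) y
    (EuclideanSpace.single a (1 : ℝ) : EuclideanSpace ℝ (Fin n))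

/-- The coordinate covector `dq^a` of the chart at `c`, at the point with coordinates `y`. -/
def coframe {n : ℕ} {M : Type*} [TopologicalSpace M] [ChartedSpace (EuclideanSpace ℝ (Fin n)) M]
    (c : M) (y : EuclideanSpace ℝ (Fin n)) (a : Fin n) :
    TangentSpace (𝓡 n) (chartInv c y) →L[ℝ] ℝ :=
  (EuclideanSpace.proj a : EuclideanSpace ℝ (Fin n) →L[ℝ] ℝ).comp
    (mfderiv (𝓡 n) 𝓘(ℝ, EuclideanSpace ℝ (Fin n)) (extChartAt (𝓡 n) c) (chartInv c y))

/-- A smooth pseudo-Riemannian metric on the `n`-manifold `M` (any signature). -/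
structure PseudoRiemannianMetric (n : ℕ) (M : Type*) [TopologicalSpace M]
    [ChartedSpace (EuclideanSpace ℝ (Fin n)) M] where
  /-- the scalar product on each tangent space -/
  val : ∀ x : M, TangentSpace (𝓡 n) x →ₗ[ℝ] TangentSpace (𝓡 n) x →ₗ[ℝ] ℝ
  symm : ∀ (x : M) (v w : TangentSpace (𝓡 n) x), val x v w = val x w v
  nondegenerate : ∀ (x : M) (v : TangentSpace (𝓡 n) x),
    (∀ w : TangentSpace (𝓡 n) x, val x v w = 0) → v = 0
  smooth : ∀ (c : M) (a b : Fin n), ContDiffOn ℝ ∞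
    (fun y => val (chartInv c y) (frame c y a) (frame c y b)) (chartDom c)

/-- A smooth symmetric contravariant two-tensor field on the `n`-manifold `M`. -/
structure SymTwoTensor (n : ℕ) (M : Type*) [TopologicalSpace M]
    [ChartedSpace (EuclideanSpace ℝ (Fin n)) M] where
  /-- the bilinear form on each cotangent space -/
  val : ∀ x : M, (TangentSpace (𝓡 n) x →L[ℝ] ℝ) →ₗ[ℝ] (TangentSpace (𝓡 n) x →L[ℝ] ℝ) →ₗ[ℝ] ℝ
  symm : ∀ (x : M) (p q : TangentSpace (𝓡 n) x →L[ℝ] ℝ), val x p q = val x q p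
  smooth : ∀ (c : M) (a b : Fin n), ContDiffOn ℝ ∞
    (fun y => val (chartInv c y) (coframe c y a) (coframe c y b)) (chartDom c)

section Coordinates

variable {n : ℕ} {M : Type*} [TopologicalSpace M] [ChartedSpace (EuclideanSpace ℝ (Fin n)) M]

/-- The partial derivative `∂_a u` of a function `u` of `n` coordinates. -/
def pd (a : Fin n) (u : EuclideanSpace ℝ (Fin n) → ℝ) (y : EuclideanSpace ℝ (Fin n)) : ℝ :=
  fderiv ℝ u y (EuclideanSpace.single a (1 : ℝ))

/-- The covariant components `g_{ab}` of the metric in the chart at `c`. -/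
def PseudoRiemannianMetric.cov (g : PseudoRiemannianMetric n M) (c : M)
    (y : EuclideanSpace ℝ (Fin n)) : Matrix (Fin n) (Fin n) ℝ :=
  Matrix.of fun a b => g.val (chartInv c y) (frame c y a) (frame c y b)

/-- The contravariant components `g^{ab}` of the metric in the chart at `c`:
the inverse matrix of `(g_{ab})`. -/
def PseudoRiemannianMetric.contra (g : PseudoRiemannianMetric n M) (c : M)
    (y : EuclideanSpace ℝ (Fin n)) : Matrix (Fin n) (Fin n) ℝ :=
  (g.cov c y)⁻¹

/-- The contravariant components `K^{ab}` in the chart at `c`. -/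
def SymTwoTensor.contra (K : SymTwoTensor n M) (c : M)
    (y : EuclideanSpace ℝ (Fin n)) : Matrix (Fin n) (Fin n) ℝ :=
  Matrix.of fun a b => K.val (chartInv c y) (coframe c y a) (coframe c y b)

/-- The Christoffel symbols
`Γ^d_{ab} = ½ g^{de} (∂_a g_{eb} + ∂_b g_{ea} - ∂_e g_{ab})` of the Levi-Civita connection
in the chart at `c`. -/
def christoffel (g : PseudoRiemannianMetric n M) (c : M) (d a b : Fin n)
    (y : EuclideanSpace ℝ (Fin n)) : ℝ :=
  (1 / 2) * ∑ e, g.contra c y d e *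
    (pd a (fun z => g.cov c z e b) y + pd b (fun z => g.cov c z e a) y
      - pd e (fun z => g.cov c z a b) y)

/-- The covariant derivative `∇_a X^b = ∂_a X^b + Γ^b_{ad} X^d` in the chart at `c`. -/
def covDeriv (g : PseudoRiemannianMetric n M) (c : M)
    (X : EuclideanSpace ℝ (Fin n) → Fin n → ℝ) (a b : Fin n)
    (y : EuclideanSpace ℝ (Fin n)) : ℝ :=
  pd a (fun z => X z b) y + ∑ d, christoffel g c b a d y * X y d

/-- `A ∇f`: the vector with components `A^{ab} ∂_b f` in the chart at `c`, where `A` gives the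
components of a contravariant two-tensor in each chart. -/
def tensorGrad (A : M → EuclideanSpace ℝ (Fin n) → Matrix (Fin n) (Fin n) ℝ) (f : M → ℝ) (c : M)
    (y : EuclideanSpace ℝ (Fin n)) (a : Fin n) : ℝ :=
  ∑ b, A c y a b * pd b (fun z => f (chartInv c z)) y

/-- The operator `Δ_A = ∇_a A^{ab} ∇_b`, evaluated at `x` in the chart at `x`.
For `A = g^{ab}` this is the Laplace-Beltrami operator. -/
def laplace (g : PseudoRiemannianMetric n M)
    (A : M → EuclideanSpace ℝ (Fin n) → Matrix (Fin n) (Fin n) ℝ) (f : M → ℝ) (x : M) : ℝ :=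
  ∑ a, covDeriv g x (tensorGrad A f x) a a (extChartAt (𝓡 n) x x)

/-- The modified quantum operator `-(ħ²/2) (Δ_A + E) + V`. -/
def quantum (hbar : ℝ) (g : PseudoRiemannianMetric n M)
    (A : M → EuclideanSpace ℝ (Fin n) → Matrix (Fin n) (Fin n) ℝ) (V E : M → ℝ)
    (ψ : M → ℝ) (x : M) : ℝ :=
  -(hbar ^ 2 / 2) * (laplace g A ψ x + E x * ψ x) + V x * ψ x

/-- The operators `Ĥ_E = -(ħ²/2)(Δ + E) + V` and `K̂_F = -(ħ²/2)(Δ_K + F) + V_K` commute on the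
open set `U`: `[Ĥ_E, K̂_F] ψ = 0` for every smooth function `ψ` on `U`. -/
def QuantumCommuteOn (hbar : ℝ) (g : PseudoRiemannianMetric n M) (V E : M → ℝ)
    (K : SymTwoTensor n M) (VK F : M → ℝ) (U : Set M) : Prop :=
  ∀ ψ : M → ℝ, ContMDiffOn (𝓡 n) 𝓘(ℝ, ℝ) ∞ ψ U → ∀ x ∈ U,
    quantum hbar g g.contra V E (quantum hbar g K.contra VK F ψ) x
      = quantum hbar g K.contra VK F (quantum hbar g g.contra V E ψ) x

/-- The function `½ A^{ab} p_a p_b + V` on the cotangent bundle, in the canonical coordinates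
`(q, p)` induced by the chart at `c`. -/
def quadFun (A : M → EuclideanSpace ℝ (Fin n) → Matrix (Fin n) (Fin n) ℝ) (V : M → ℝ) (c : M)
    (q p : EuclideanSpace ℝ (Fin n)) : ℝ :=
  (1 / 2) * ∑ a, ∑ b, A c q a b * p a * p b + V (chartInv c q)

/-- The canonical Poisson bracket of two functions of the canonical coordinates `(q, p)`. -/
def poisson (G L : EuclideanSpace ℝ (Fin n) → EuclideanSpace ℝ (Fin n) → ℝ)
    (q p : EuclideanSpace ℝ (Fin n)) : ℝ :=
  ∑ a, (pd a (fun z => G z p) q * pd a (fun r => L q r) p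
    - pd a (fun r => G q r) p * pd a (fun z => L z p) q)

/-- `K = ½ K^{ab} p_a p_b + V_K` is a first integral of `H = ½ g^{ab} p_a p_b + V`:
`{H, K} = 0` on the cotangent bundle. -/
def IsFirstIntegral (g : PseudoRiemannianMetric n M) (V : M → ℝ)
    (K : SymTwoTensor n M) (VK : M → ℝ) : Prop :=
  ∀ (c : M), ∀ q ∈ (chartDom c : Set (EuclideanSpace ℝ (Fin n))),
    ∀ p : EuclideanSpace ℝ (Fin n),
      poisson (quadFun g.contra V c) (quadFun K.contra VK c) q p = 0

/-- The one-form `K∇f`, with components `g_{ab} K^{bd} ∂_d f` in the chart at `c`. -/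
def gradForm (g : PseudoRiemannianMetric n M) (K : SymTwoTensor n M) (f : M → ℝ) (c : M)
    (y : EuclideanSpace ℝ (Fin n)) (a : Fin n) : ℝ :=
  ∑ b, g.cov c y a b * tensorGrad K.contra f c y b

/-- The components `∂_a θ_b - ∂_b θ_a` of `dθ` for the one-form with components `θ`. -/
def extD (θ : EuclideanSpace ℝ (Fin n) → Fin n → ℝ) (a b : Fin n)
    (y : EuclideanSpace ℝ (Fin n)) : ℝ :=
  pd a (fun z => θ z b) y - pd b (fun z => θ z a) y

/-- Equality `dθ = dθ'` on `M` of the exterior derivatives of two one-forms, given by their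
components in each chart. -/
def SameExtD (θ θ' : M → EuclideanSpace ℝ (Fin n) → Fin n → ℝ) : Prop :=
  ∀ (c : M), ∀ y ∈ (chartDom c : Set (EuclideanSpace ℝ (Fin n))), ∀ a b : Fin n,
    extD (θ c) a b y = extD (θ' c) a b y

/-- The one-form given by its components in each chart is closed. -/
def IsClosedForm (θ : M → EuclideanSpace ℝ (Fin n) → Fin n → ℝ) : Prop :=
  ∀ (c : M), ∀ y ∈ (chartDom c : Set (EuclideanSpace ℝ (Fin n))), ∀ a b : Fin n,
    extD (θ c) a b y = 0

/-- `f` is a potential of the one-form `θ` on the open set `U`: `f` is smooth and `df = θ` there. -/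
def IsPotentialOn (f : M → ℝ) (θ : M → EuclideanSpace ℝ (Fin n) → Fin n → ℝ) (U : Set M) : Prop :=
  ContMDiffOn (𝓡 n) 𝓘(ℝ, ℝ) ∞ f U ∧
    ∀ (c : M), ∀ y ∈ (chartDom c : Set (EuclideanSpace ℝ (Fin n))), chartInv c y ∈ U →
      ∀ a : Fin n, pd a (fun z => f (chartInv c z)) y = θ c y a

/-- `W` is, on the open set `U`, a family of smooth quantum corrections of the `K^(i)` which all
go with the single quantum correction `E` of `H`: `[Ĥ_E, K̂^(i)_{W^(i)}] = 0` for every `i`. -/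
def IsSimultaneousOn (hbar : ℝ) (g : PseudoRiemannianMetric n M) (V E : M → ℝ) {k : ℕ}
    (K : Fin k → SymTwoTensor n M) (VK W : Fin k → M → ℝ) (U : Set M) : Prop :=
  ∀ i, ContMDiffOn (𝓡 n) 𝓘(ℝ, ℝ) ∞ (W i) U ∧
    QuantumCommuteOn hbar g V E (K i) (VK i) (W i) U

end Coordinates

end MLB

end

/-!
The operators with corrections `E`, `W` differ from the commuting pair with corrections `E₀`, `F₀`
by multiplication operators, so their commutator is, up to a non-zero constant,
`[Δ, W - F₀] - [Δ_K, E - E₀]`. Since `[Δ_A, f] ψ = 2 A(df, dψ) + ψ Δ_A f`, this is a first-order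
operator (`quantum_commutator`). Testing it on the constant `1` and on smooth functions that
agree with a coordinate near a point, one finds that it vanishes if and only if the vector fields
`g⁻¹ d(W - F₀)` and `K d(E - E₀)` agree; the zeroth-order terms are their divergences, and then
agree as well (`quantumCommuteOn_iff_tensorGrad_eq`). Lowering the index, this says that `W - F₀`
is a potential of the one-form `K∇(E - E₀)`. Locally such potentials exist exactly when the
form is closed, and on a simply connected manifold they then exist globally.

Two points need work. The operator `Δ_A` is defined at each point through the chart at that
point, so even the smoothness of `Δ_A ψ`, without which the operators could not be composed
linearly, depends on the invariance of the divergence under changes of coordinates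
(`coordDiv_change`, `laplace_chartInv`). The global potential is a section of the covering space
of germs of local potentials, realised as a fibre bundle with discrete fibre
(`exists_glue_of_locally_const`); the local ones come from the Poincaré lemma on a ball in a chart.
-/

open scoped ContDiff Manifold

noncomputable section

namespace MLB

variable {n : ℕ}

local notation "𝔼" => EuclideanSpace ℝ (Fin n)

/-! ### Partial derivatives and the divergence in coordinates -/

theorem pd_congr {u v : 𝔼 → ℝ} {y : 𝔼} (h : u =ᶠ[nhds y] v) (a : Fin n) : pd a u y = pd a v y := by
  simp only [pd, h.fderiv_eq]

theorem pd_const (c : ℝ) (a : Fin n) (y : 𝔼) : pd a (fun _ => c) y = 0 := by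
  simp [pd]

theorem pd_add {u v : 𝔼 → ℝ} {y : 𝔼} (hu : DifferentiableAt ℝ u y) (hv : DifferentiableAt ℝ v y)
    (a : Fin n) : pd a (fun z => u z + v z) y = pd a u y + pd a v y := by
  simp [pd, fderiv_fun_add hu hv]

theorem pd_sub {u v : 𝔼 → ℝ} {y : 𝔼} (hu : DifferentiableAt ℝ u y) (hv : DifferentiableAt ℝ v y)
    (a : Fin n) : pd a (fun z => u z - v z) y = pd a u y - pd a v y := by
  simp [pd, fderiv_fun_sub hu hv]

theorem pd_mul {u v : 𝔼 → ℝ} {y : 𝔼} (hu : DifferentiableAt ℝ u y) (hv : DifferentiableAt ℝ v y)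
    (a : Fin n) : pd a (fun z => u z * v z) y = pd a u y * v y + u y * pd a v y := by
  simp [pd, fderiv_fun_mul hu hv]; ring

theorem pd_sum {ι : Type*} {s : Finset ι} {u : ι → 𝔼 → ℝ} {y : 𝔼}
    (hu : ∀ i ∈ s, DifferentiableAt ℝ (u i) y) (a : Fin n) :
    pd a (fun z => ∑ i ∈ s, u i z) y = ∑ i ∈ s, pd a (u i) y := by
  simp [pd, fderiv_fun_sum hu]

theorem fderiv_apply_eq_sum_pd (u : 𝔼 → ℝ) (y v : 𝔼) :
    fderiv ℝ u y v = ∑ a, v a * pd a u y := by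
  conv_lhs => rw [← (EuclideanSpace.basisFun (Fin n) ℝ).sum_repr v]
  simp [pd]

theorem pd_apply {τ : 𝔼 → 𝔼} {y : 𝔼} (hτ : DifferentiableAt ℝ τ y) (i a : Fin n) :
    pd a (fun z => τ z i) y = fderiv ℝ τ y (EuclideanSpace.single a 1) i := by
  have h := (EuclideanSpace.proj i : 𝔼 →L[ℝ] ℝ).hasFDerivAt.comp y
    hτ.hasFDerivAt
  have h2 : HasFDerivAt (fun z => τ z i) _ y := h
  simp [pd, h2.fderiv]

theorem pd_comp {u : 𝔼 → ℝ} {τ : 𝔼 → 𝔼} {y : 𝔼} (hu : DifferentiableAt ℝ u (τ y))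
    (hτ : DifferentiableAt ℝ τ y) (a : Fin n) :
    pd a (fun z => u (τ z)) y = ∑ i, pd a (fun z => τ z i) y * pd i u (τ y) := by
  have h : HasFDerivAt (fun z => u (τ z)) _ y := hu.hasFDerivAt.comp y hτ.hasFDerivAt
  rw [pd, h.fderiv]
  simp only [ContinuousLinearMap.comp_apply, fderiv_apply_eq_sum_pd u, pd_apply hτ]

theorem pd_comm {u : 𝔼 → ℝ} {y : 𝔼} (hu : ContDiffAt ℝ ∞ u y) (a b : Fin n) :
    pd a (fun z => pd b u z) y = pd b (fun z => pd a u z) y := by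
  have hd : DifferentiableAt ℝ (fderiv ℝ u) y :=
    (hu.fderiv_right (m := 1) (by norm_cast)).differentiableAt (by norm_num)
  have key : ∀ a b : Fin n, pd a (fun z => pd b u z) y =
      fderiv ℝ (fderiv ℝ u) y (EuclideanSpace.single a 1) (EuclideanSpace.single b 1) := by
    intro a b
    have := (hd.hasFDerivAt.clm_apply (hasFDerivAt_const (EuclideanSpace.single b (1:ℝ)) y))
    have h2 : HasFDerivAt (fun z => pd b u z) _ y := this
    rw [pd, h2.fderiv]
    simp
  have hs : IsSymmSndFDerivAt ℝ u y := (hu.of_le (by norm_cast)).isSymmSndFDerivAt (n := 2) (by simp)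
  rw [key, key, hs.eq]

theorem contDiffOn_pd {u : 𝔼 → ℝ} {s : Set 𝔼} (hs : IsOpen s) (hu : ContDiffOn ℝ ∞ u s)
    (a : Fin n) : ContDiffOn ℝ ∞ (fun z => pd a u z) s :=
  (hu.fderiv_of_isOpen hs (m := ∞) (by norm_cast)).clm_apply contDiffOn_const

theorem contDiffAt_pd {u : 𝔼 → ℝ} {y : 𝔼} (hu : ContDiffAt ℝ ∞ u y)
    (a : Fin n) : ContDiffAt ℝ ∞ (fun z => pd a u z) y :=
  (hu.fderiv_right (m := ∞) (by norm_cast)).clm_apply contDiffAt_const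

/-- The entrywise partial derivative of a matrix-valued function. -/
def pdM (a : Fin n) (A : 𝔼 → Matrix (Fin n) (Fin n) ℝ) (y : 𝔼) : Matrix (Fin n) (Fin n) ℝ :=
  Matrix.of fun i j => pd a (fun z => A z i j) y

/-- The Jacobian matrix of a map between coordinate spaces: rows are indexed by the components of
the map, columns by the variables. -/
def jac (τ : 𝔼 → 𝔼) (y : 𝔼) : Matrix (Fin n) (Fin n) ℝ :=
  Matrix.of fun i a => pd a (fun z => τ z i) y

theorem pdM_mul {A B : 𝔼 → Matrix (Fin n) (Fin n) ℝ} {y : 𝔼}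
    (hA : ∀ i j, DifferentiableAt ℝ (fun z => A z i j) y)
    (hB : ∀ i j, DifferentiableAt ℝ (fun z => B z i j) y) (a : Fin n) :
    pdM a (fun z => A z * B z) y = pdM a A y * B y + A y * pdM a B y := by
  ext i j
  simp only [pdM, Matrix.of_apply, Matrix.mul_apply, Matrix.add_apply]
  rw [pd_sum (fun k _ => (hA i k).fun_mul (hB k j)), ← Finset.sum_add_distrib]
  exact Finset.sum_congr rfl fun k _ => pd_mul (hA i k) (hB k j) a

theorem jac_mul_jac_eq_one {τ σ : 𝔼 → 𝔼} {y : 𝔼} (hτ : DifferentiableAt ℝ τ y)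
    (hσ : DifferentiableAt ℝ σ (τ y)) (h : (fun z => σ (τ z)) =ᶠ[nhds y] id) :
    jac σ (τ y) * jac τ y = 1 := by
  ext i a
  have hσi : DifferentiableAt ℝ (fun z => σ z i) (τ y) :=
    (EuclideanSpace.proj i : 𝔼 →L[ℝ] ℝ).differentiableAt.comp _ hσ
  have h1 := pd_comp hσi hτ a
  have h2 : pd a (fun z => σ (τ z) i) y = pd a (fun z : 𝔼 => z i) y :=
    pd_congr (h.mono fun z hz => by simp only [hz, id]) a
  have h3 : pd a (fun z : 𝔼 => z i) y = (1 : Matrix (Fin n) (Fin n) ℝ) i a := by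
    rw [pd_apply (τ := fun z => z) differentiableAt_fun_id]
    simp [Matrix.one_apply]
  rw [← h3, ← h2, h1]
  simp only [Matrix.mul_apply, jac, Matrix.of_apply]
  exact Finset.sum_congr rfl fun _ _ => mul_comm _ _

/-- The coordinate expression `∂_a X^a + ½ X^d tr(G⁻¹ ∂_d G)` of the divergence of the vector field
`X` with respect to the metric with components `G`. -/
def coordDiv (G : 𝔼 → Matrix (Fin n) (Fin n) ℝ) (X : 𝔼 → Fin n → ℝ) (y : 𝔼) : ℝ :=
  ∑ a, pd a (fun z => X z a) y + (1 / 2) * ∑ d, X y d * ((G y)⁻¹ * pdM d G y).trace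

theorem coordDiv_congr {G : 𝔼 → Matrix (Fin n) (Fin n) ℝ} {X Y : 𝔼 → Fin n → ℝ} {y : 𝔼}
    (h : X =ᶠ[nhds y] Y) : coordDiv G X y = coordDiv G Y y := by
  simp only [coordDiv, h.eq_of_nhds]
  congr 1
  exact Finset.sum_congr rfl fun a _ => pd_congr (h.mono fun z hz => by simp only [hz]) a

/-- If `G` is the pullback of `G'` by `τ`, the logarithmic derivatives of their determinants
differ by that of the square of the Jacobian determinant. -/
theorem trace_inv_mul_pdM_pullback {τ : 𝔼 → 𝔼} {y : 𝔼} (hτ : ContDiffAt ℝ ∞ τ y)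
    {G G' : 𝔼 → Matrix (Fin n) (Fin n) ℝ} {Q : Matrix (Fin n) (Fin n) ℝ} (hQ : Q * jac τ y = 1)
    (hG' : ∀ i j, DifferentiableAt ℝ (fun z => G' z i j) (τ y)) (hdet : IsUnit (G' (τ y)).det)
    (hG : ∀ᶠ z in nhds y, G z = (jac τ z).transpose * G' (τ z) * jac τ z) (d : Fin n) :
    ((G y)⁻¹ * pdM d G y).trace = 2 * (Q * pdM d (jac τ) y).trace
      + ∑ i, jac τ y i d * ((G' (τ y))⁻¹ * pdM i G' (τ y)).trace := by
  have hτi : ∀ i, ContDiffAt ℝ ∞ (fun z => τ z i) y := fun i =>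
    (EuclideanSpace.proj i : 𝔼 →L[ℝ] ℝ).contDiff.contDiffAt.comp _ hτ
  have hJ : ∀ i j, DifferentiableAt ℝ (fun z => jac τ z i j) y := fun i j =>
    (contDiffAt_pd (hτi i) j).differentiableAt (by simp)
  have hτd : DifferentiableAt ℝ τ y := hτ.differentiableAt (by simp)
  have hGτ : ∀ i j, DifferentiableAt ℝ (fun z => G' (τ z) i j) y := fun i j =>
    DifferentiableAt.comp (g := fun z => G' z i j) y (hG' i j) hτd
  have hJT : ∀ i j, DifferentiableAt ℝ (fun z => (jac τ z).transpose i j) y := fun i j => hJ j i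
  have hprod : ∀ i j, DifferentiableAt ℝ (fun z => ((jac τ z).transpose * G' (τ z)) i j) y := by
    intro i j
    simp only [Matrix.mul_apply]
    exact DifferentiableAt.fun_sum fun k _ => (hJT i k).fun_mul (hGτ k j)
  have e1 : pdM d G y = (pdM d (jac τ) y).transpose * G' (τ y) * jac τ y
      + (jac τ y).transpose * pdM d (fun z => G' (τ z)) y * jac τ y
      + (jac τ y).transpose * G' (τ y) * pdM d (jac τ) y := by
    have : pdM d G y = pdM d (fun z => (jac τ z).transpose * G' (τ z) * jac τ z) y := by
      ext i j
      exact pd_congr (hG.mono fun z hz => by simp only [hz]) d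
    rw [this, pdM_mul hprod hJ, pdM_mul hJT hGτ, Matrix.add_mul]
    rfl
  have e2 : pdM d (fun z => G' (τ z)) y = ∑ i, jac τ y i d • pdM i G' (τ y) := by
    ext i j
    simp only [pdM, Matrix.of_apply, Matrix.sum_apply, Matrix.smul_apply, smul_eq_mul]
    exact pd_comp (hG' i j) hτd d
  have hP : jac τ y * Q = 1 := mul_eq_one_comm.1 hQ
  have hQT : Q.transpose * (jac τ y).transpose = 1 := by
    rw [← Matrix.transpose_mul, hP, Matrix.transpose_one]
  have hPT : (jac τ y).transpose * Q.transpose = 1 := mul_eq_one_comm.1 hQT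
  have e3 : (G y)⁻¹ = Q * (G' (τ y))⁻¹ * Q.transpose := by
    apply Matrix.inv_eq_left_inv
    rw [hG.self_of_nhds]
    calc _ = Q * ((G' (τ y))⁻¹ * (Q.transpose * (jac τ y).transpose) * G' (τ y)) * jac τ y := by
          simp only [Matrix.mul_assoc]
      _ = 1 := by rw [hQT, Matrix.mul_one, Matrix.nonsing_inv_mul _ hdet, Matrix.mul_one, hQ]
  have t1 : ((G y)⁻¹ * ((pdM d (jac τ) y).transpose * G' (τ y) * jac τ y)).trace
      = (Q * pdM d (jac τ) y).trace := by
    calc _ = (Q * ((G' (τ y))⁻¹ * Q.transpose * ((pdM d (jac τ) y).transpose * G' (τ y)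
            * jac τ y))).trace := by rw [e3]; simp only [Matrix.mul_assoc]
      _ = ((G' (τ y))⁻¹ * (Q.transpose * (pdM d (jac τ) y).transpose * G' (τ y)
            * (jac τ y * Q))).trace := by rw [Matrix.trace_mul_comm]; simp only [Matrix.mul_assoc]
      _ = (Q.transpose * (pdM d (jac τ) y).transpose * (G' (τ y) * (G' (τ y))⁻¹)).trace := by
          rw [hP, Matrix.mul_one, Matrix.trace_mul_comm]; simp only [Matrix.mul_assoc]
      _ = (Q * pdM d (jac τ) y).trace := by
          rw [Matrix.mul_nonsing_inv _ hdet, Matrix.mul_one, ← Matrix.transpose_mul,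
            Matrix.trace_transpose, Matrix.trace_mul_comm]
  have t2 : ((G y)⁻¹ * ((jac τ y).transpose * pdM d (fun z => G' (τ z)) y * jac τ y)).trace
      = ((G' (τ y))⁻¹ * pdM d (fun z => G' (τ z)) y).trace := by
    calc _ = (Q * ((G' (τ y))⁻¹ * (Q.transpose * (jac τ y).transpose)
            * pdM d (fun z => G' (τ z)) y * jac τ y)).trace := by
          rw [e3]; simp only [Matrix.mul_assoc]
      _ = ((G' (τ y))⁻¹ * pdM d (fun z => G' (τ z)) y * (jac τ y * Q)).trace := by
          rw [hQT, Matrix.mul_one, Matrix.trace_mul_comm]; simp only [Matrix.mul_assoc]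
      _ = _ := by rw [hP, Matrix.mul_one]
  have t3 : ((G y)⁻¹ * ((jac τ y).transpose * G' (τ y) * pdM d (jac τ) y)).trace
      = (Q * pdM d (jac τ) y).trace := by
    calc _ = (Q * ((G' (τ y))⁻¹ * (Q.transpose * (jac τ y).transpose)
            * G' (τ y)) * pdM d (jac τ) y).trace := by
          rw [e3]; simp only [Matrix.mul_assoc]
      _ = _ := by rw [hQT, Matrix.mul_one, Matrix.nonsing_inv_mul _ hdet, Matrix.mul_one]
  rw [e1, Matrix.mul_add, Matrix.mul_add, Matrix.trace_add, Matrix.trace_add, t1, t2, t3, e2,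
    Matrix.mul_sum, Matrix.trace_sum]
  simp only [Matrix.mul_smul, Matrix.trace_smul, smul_eq_mul]
  ring

/-- The divergence does not depend on the coordinates. -/
theorem coordDiv_change {τ : 𝔼 → 𝔼} {y : 𝔼} (hτ : ContDiffAt ℝ ∞ τ y)
    {G G' : 𝔼 → Matrix (Fin n) (Fin n) ℝ} {X X' : 𝔼 → Fin n → ℝ}
    {Q : Matrix (Fin n) (Fin n) ℝ} (hQ : Q * jac τ y = 1)
    (hG' : ∀ i j, DifferentiableAt ℝ (fun z => G' z i j) (τ y)) (hdet : IsUnit (G' (τ y)).det)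
    (hG : ∀ᶠ z in nhds y, G z = (jac τ z).transpose * G' (τ z) * jac τ z)
    (hX : ∀ a, DifferentiableAt ℝ (fun z => X z a) y)
    (hX' : ∀ a, DifferentiableAt ℝ (fun z => X' z a) (τ y))
    (hXX' : ∀ᶠ z in nhds y, X' (τ z) = (jac τ z).mulVec (X z)) :
    coordDiv G X y = coordDiv G' X' (τ y) := by
  have hτi : ∀ i, ContDiffAt ℝ ∞ (fun z => τ z i) y := fun i =>
    (EuclideanSpace.proj i : 𝔼 →L[ℝ] ℝ).contDiff.contDiffAt.comp _ hτ
  have hJ : ∀ i j, DifferentiableAt ℝ (fun z => jac τ z i j) y := fun i j =>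
    (contDiffAt_pd (hτi i) j).differentiableAt (by simp)
  have hτd : DifferentiableAt ℝ τ y := hτ.differentiableAt (by simp)
  have hP : jac τ y * Q = 1 := mul_eq_one_comm.1 hQ
  set D : Matrix (Fin n) (Fin n) ℝ := Matrix.of fun a b => pd b (fun z => X z a) y with hD
  set D' : Matrix (Fin n) (Fin n) ℝ := Matrix.of fun a b => pd b (fun z => X' z a) (τ y) with hD'
  set S : Matrix (Fin n) (Fin n) ℝ :=
    Matrix.of fun j b => ∑ a, pd b (fun z => jac τ z j a) y * X y a with hS
  have e1 : D' * jac τ y = jac τ y * D + S := by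
    ext j b
    have h1 := pd_comp (hX' j) hτd b
    have h2 : pd b (fun z => X' (τ z) j) y = pd b (fun z => ∑ a, jac τ z j a * X z a) y :=
      pd_congr (hXX'.mono fun z hz => by simp only [hz, Matrix.mulVec, dotProduct]) b
    rw [pd_sum (fun a _ => (hJ j a).fun_mul (hX a)), h1] at h2
    simp only [Matrix.mul_apply, Matrix.add_apply, hD', hD, hS, Matrix.of_apply]
    rw [← Finset.sum_add_distrib]
    calc _ = ∑ i, pd b (fun z => τ z i) y * pd i (fun z => X' z j) (τ y) :=
          Finset.sum_congr rfl fun i _ => mul_comm _ _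
      _ = _ := h2
      _ = _ := Finset.sum_congr rfl fun a _ => by rw [pd_mul (hJ j a) (hX a), add_comm]
  have e2 : D'.trace = D.trace + (S * Q).trace := by
    calc D'.trace = (D' * jac τ y * Q).trace := by rw [Matrix.mul_assoc, hP, Matrix.mul_one]
      _ = _ := by
        rw [e1, Matrix.add_mul, Matrix.trace_add, Matrix.trace_mul_comm, ← Matrix.mul_assoc, hQ,
          Matrix.one_mul]
  have e3 : (S * Q).trace = ∑ d, X y d * (Q * pdM d (jac τ) y).trace := by
    rw [Matrix.trace_mul_comm]
    simp only [Matrix.trace, Matrix.diag, Matrix.mul_apply, hS, pdM, Matrix.of_apply,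
      Finset.mul_sum]
    rw [Finset.sum_comm' (t' := Finset.univ) (s' := fun _ => Finset.univ) (by simp)]
    conv_lhs => enter [2, j]; rw [Finset.sum_comm]
    rw [Finset.sum_comm]
    refine Finset.sum_congr rfl fun d _ => ?_
    rw [Finset.sum_comm]
    refine Finset.sum_congr rfl fun b _ => Finset.sum_congr rfl fun j _ => ?_
    have : pd b (fun z => jac τ z j d) y = pd d (fun z => jac τ z j b) y := pd_comm (hτi j) b d
    rw [this]; ring
  have e4 : ∑ i, X' (τ y) i * ((G' (τ y))⁻¹ * pdM i G' (τ y)).trace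
      = ∑ d, X y d * ∑ i, jac τ y i d * ((G' (τ y))⁻¹ * pdM i G' (τ y)).trace := by
    rw [hXX'.self_of_nhds]
    simp only [Matrix.mulVec, dotProduct, Finset.mul_sum, Finset.sum_mul]
    rw [Finset.sum_comm]
    exact Finset.sum_congr rfl fun _ _ => Finset.sum_congr rfl fun _ _ => by ring
  have hDt : ∑ a, pd a (fun z => X z a) y = D.trace := rfl
  have hDt' : ∑ a, pd a (fun z => X' z a) (τ y) = D'.trace := rfl
  rw [coordDiv, coordDiv, hDt, hDt', e2, e3, e4]
  simp only [trace_inv_mul_pdM_pullback hτ hQ hG' hdet hG, mul_add, Finset.sum_add_distrib]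
  simp only [Finset.mul_sum]
  rw [← add_assoc]
  congr 2
  exact Finset.sum_congr rfl fun _ _ => by ring_nf

/-! ### Changes of charts and tensor fields -/

section Charts

variable {M : Type*} [TopologicalSpace M] [ChartedSpace (EuclideanSpace ℝ (Fin n)) M]

/-- The part of the coordinate domain of the chart at `c` that corresponds to points of `U`. -/
def domOn (c : M) (U : Set M) : Set 𝔼 :=
  chartDom c ∩ chartInv c ⁻¹' U

/-- The coordinate transition from the chart at `c` to the chart at `c'`. -/
def trans (c c' : M) (y : 𝔼) : 𝔼 :=
  extChartAt (𝓡 n) c' (chartInv c y)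

theorem isOpen_chartDom (c : M) : IsOpen (chartDom c : Set 𝔼) :=
  isOpen_extChartAt_target c

theorem continuousOn_chartInv (c : M) : ContinuousOn (chartInv c) (chartDom c : Set 𝔼) :=
  continuousOn_extChartAt_symm c

theorem isOpen_domOn (c : M) {U : Set M} (hU : IsOpen U) : IsOpen (domOn c U : Set 𝔼) :=
  (continuousOn_chartInv c).isOpen_inter_preimage (isOpen_chartDom c) hU

theorem domOn_univ (c : M) : (domOn c Set.univ : Set 𝔼) = chartDom c := by
  simp [domOn]

theorem chartInv_mem_source {c : M} {y : 𝔼} (hy : y ∈ (chartDom c : Set 𝔼)) :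
    chartInv c y ∈ (extChartAt (𝓡 n) c).source :=
  (extChartAt (𝓡 n) c).map_target hy

theorem extChartAt_chartInv {c : M} {y : 𝔼} (hy : y ∈ (chartDom c : Set 𝔼)) :
    extChartAt (𝓡 n) c (chartInv c y) = y :=
  (extChartAt (𝓡 n) c).right_inv hy

theorem chartInv_extChartAt {c x : M} (hx : x ∈ (extChartAt (𝓡 n) c).source) :
    chartInv c (extChartAt (𝓡 n) c x) = x :=
  (extChartAt (𝓡 n) c).left_inv hx

theorem extChartAt_mem_chartDom {c x : M} (hx : x ∈ (extChartAt (𝓡 n) c).source) :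
    extChartAt (𝓡 n) c x ∈ (chartDom c : Set 𝔼) :=
  (extChartAt (𝓡 n) c).map_source hx

theorem center_mem_domOn {x : M} {U : Set M} (hx : x ∈ U) :
    extChartAt (𝓡 n) x x ∈ (domOn x U : Set 𝔼) :=
  ⟨extChartAt_mem_chartDom (mem_extChartAt_source x), by
    rwa [Set.mem_preimage, chartInv_extChartAt (mem_extChartAt_source x)]⟩

theorem chartInv_trans {c c' : M} {y : 𝔼} (hy : y ∈ domOn c (extChartAt (𝓡 n) c').source) :
    chartInv c' (trans c c' y) = chartInv c y :=
  chartInv_extChartAt hy.2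

theorem trans_mem {c c' : M} {y : 𝔼} (hy : y ∈ domOn c (extChartAt (𝓡 n) c').source) :
    trans c c' y ∈ domOn c' (extChartAt (𝓡 n) c).source :=
  ⟨extChartAt_mem_chartDom hy.2, by
    rw [Set.mem_preimage, chartInv_trans hy]; exact chartInv_mem_source hy.1⟩

theorem trans_trans {c c' : M} {y : 𝔼} (hy : y ∈ domOn c (extChartAt (𝓡 n) c').source) :
    trans c' c (trans c c' y) = y := by
  rw [trans, chartInv_trans hy, extChartAt_chartInv hy.1]

theorem overlap_mem_nhds {c c' : M} {y : 𝔼} (hy : y ∈ domOn c (extChartAt (𝓡 n) c').source) :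
    domOn c (extChartAt (𝓡 n) c').source ∈ nhds y :=
  (isOpen_domOn c (isOpen_extChartAt_source c')).mem_nhds hy

/-- The value of the metric at `x` as a bilinear form on the model space. -/
def PseudoRiemannianMetric.form (g : PseudoRiemannianMetric n M) (x : M) : 𝔼 →ₗ[ℝ] 𝔼 →ₗ[ℝ] ℝ :=
  g.val x

/-- The value of the tensor at `x` as a bilinear form on the dual of the model space. -/
def SymTwoTensor.form (K : SymTwoTensor n M) (x : M) : (𝔼 →L[ℝ] ℝ) →ₗ[ℝ] (𝔼 →L[ℝ] ℝ) →ₗ[ℝ] ℝ :=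
  K.val x

/-- The derivative of the inverse chart, as an endomorphism of the model space. -/
def dChartInv (c : M) (y : 𝔼) : 𝔼 →L[ℝ] 𝔼 :=
  mfderiv 𝓘(ℝ, 𝔼) (𝓡 n) (chartInv (n := n) c) y

/-- The derivative of the chart at `c`, as an endomorphism of the model space. -/
def dChart (c : M) (x : M) : 𝔼 →L[ℝ] 𝔼 :=
  mfderiv (𝓡 n) 𝓘(ℝ, 𝔼) (extChartAt (𝓡 n) c) x

theorem cov_apply (g : PseudoRiemannianMetric n M) (c : M) (y : 𝔼) (a b : Fin n) :
    g.cov c y a b = g.form (chartInv c y) (dChartInv c y (EuclideanSpace.single a 1))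
      (dChartInv c y (EuclideanSpace.single b 1)) := rfl

theorem contra_apply (K : SymTwoTensor n M) (c : M) (y : 𝔼) (a b : Fin n) :
    K.contra c y a b = K.form (chartInv c y)
      ((EuclideanSpace.proj a : 𝔼 →L[ℝ] ℝ).comp (dChart c (chartInv c y)))
      ((EuclideanSpace.proj b : 𝔼 →L[ℝ] ℝ).comp (dChart c (chartInv c y))) := rfl

theorem cov_symm (g : PseudoRiemannianMetric n M) (c : M) (y : 𝔼) :
    (g.cov c y).transpose = g.cov c y := by
  ext a b
  exact g.symm _ _ _

theorem clm_apply_single_sum (L : 𝔼 →L[ℝ] 𝔼) (v : 𝔼) :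
    L v = ∑ i, v i • L (EuclideanSpace.single i 1) := by
  conv_lhs => rw [← (EuclideanSpace.basisFun (Fin n) ℝ).sum_repr v]
  simp

variable [IsManifold (𝓡 n) ∞ M]

theorem contMDiffAt_chartInv {c : M} {y : 𝔼} (hy : y ∈ (chartDom c : Set 𝔼)) :
    ContMDiffAt 𝓘(ℝ, 𝔼) (𝓡 n) ∞ (chartInv c) y :=
  (contMDiffOn_extChartAt_symm c).contMDiffAt ((isOpen_chartDom c).mem_nhds hy)

theorem contMDiffAt_extChart {c x : M} (hx : x ∈ (extChartAt (𝓡 n) c).source) :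
    ContMDiffAt (𝓡 n) 𝓘(ℝ, 𝔼) ∞ (extChartAt (𝓡 n) c) x :=
  contMDiffAt_extChartAt' (by simpa using hx)

theorem contDiffAt_trans {c c' : M} {y : 𝔼} (hy : y ∈ domOn c (extChartAt (𝓡 n) c').source) :
    ContDiffAt ℝ ∞ (trans c c') y :=
  ((contMDiffAt_extChart hy.2).comp y (contMDiffAt_chartInv hy.1)).contDiffAt

theorem differentiableAt_trans {c c' : M} {y : 𝔼}
    (hy : y ∈ domOn c (extChartAt (𝓡 n) c').source) : DifferentiableAt ℝ (trans c c') y :=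
  (contDiffAt_trans hy).differentiableAt (by simp)

/-- The Jacobian matrices of mutually inverse transitions are inverse to each other. -/
theorem jac_trans_mul {c c' : M} {y : 𝔼} (hy : y ∈ domOn c (extChartAt (𝓡 n) c').source) :
    jac (trans c' c) (trans c c' y) * jac (trans c c') y = 1 :=
  jac_mul_jac_eq_one (differentiableAt_trans hy) (differentiableAt_trans (trans_mem hy))
    ((Filter.eventually_of_mem (overlap_mem_nhds hy)) fun _ hz => trans_trans hz)

theorem hasMFDerivAt_chartInv {c : M} {y : 𝔼} (hy : y ∈ (chartDom c : Set 𝔼)) :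
    HasMFDerivAt 𝓘(ℝ, 𝔼) (𝓡 n) (chartInv c) y (dChartInv c y) :=
  ((contMDiffAt_chartInv hy).mdifferentiableAt (by simp)).hasMFDerivAt

theorem hasMFDerivAt_extChart {c x : M} (hx : x ∈ (extChartAt (𝓡 n) c).source) :
    HasMFDerivAt (𝓡 n) 𝓘(ℝ, 𝔼) (extChartAt (𝓡 n) c) x (dChart c x) :=
  ((contMDiffAt_extChart hx).mdifferentiableAt (by simp)).hasMFDerivAt

theorem dChartInv_eq_comp {c c' : M} {y : 𝔼} (hy : y ∈ domOn c (extChartAt (𝓡 n) c').source) :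
    dChartInv c y = (dChartInv c' (trans c c' y)).comp (fderiv ℝ (trans c c') y) := by
  have h1 : HasMFDerivAt 𝓘(ℝ, 𝔼) (𝓡 n) (chartInv c' ∘ trans c c') y
      ((dChartInv c' (trans c c' y)).comp (fderiv ℝ (trans c c') y)) :=
    (hasMFDerivAt_chartInv (trans_mem hy).1).comp y
      (differentiableAt_trans hy).hasFDerivAt.hasMFDerivAt
  have h2 : chartInv c =ᶠ[nhds y] chartInv c' ∘ trans c c' :=
    Filter.eventually_of_mem (overlap_mem_nhds hy) fun _ hz => (chartInv_trans hz).symm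
  exact (h1.congr_of_eventuallyEq h2).mfderiv

theorem dChart_eq_comp {c c' : M} {y : 𝔼} (hy : y ∈ domOn c (extChartAt (𝓡 n) c').source) :
    dChart c' (chartInv c y) = (fderiv ℝ (trans c c') y).comp (dChart c (chartInv c y)) := by
  have hs := chartInv_mem_source hy.1
  have h0 : HasMFDerivAt 𝓘(ℝ, 𝔼) 𝓘(ℝ, 𝔼) (trans c c') (extChartAt (𝓡 n) c (chartInv c y))
      (fderiv ℝ (trans c c') y) := by
    rw [extChartAt_chartInv hy.1]
    exact (differentiableAt_trans hy).hasFDerivAt.hasMFDerivAt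
  have h1 : HasMFDerivAt (𝓡 n) 𝓘(ℝ, 𝔼) (trans c c' ∘ extChartAt (𝓡 n) c) (chartInv c y)
      ((fderiv ℝ (trans c c') y).comp (dChart c (chartInv c y))) :=
    h0.comp (chartInv c y) (hasMFDerivAt_extChart hs)
  have h2 : extChartAt (𝓡 n) c' =ᶠ[nhds (chartInv c y)] trans c c' ∘ extChartAt (𝓡 n) c :=
    Filter.eventually_of_mem ((isOpen_extChartAt_source c).mem_nhds hs) fun z hz => by
      simp only [Function.comp, trans, chartInv_extChartAt hz]
  exact (h1.congr_of_eventuallyEq h2).mfderiv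

theorem dChart_comp_dChartInv {c : M} {y : 𝔼} (hy : y ∈ (chartDom c : Set 𝔼)) :
    (dChart c (chartInv c y)).comp (dChartInv c y) = ContinuousLinearMap.id ℝ 𝔼 := by
  have h1 : HasMFDerivAt 𝓘(ℝ, 𝔼) 𝓘(ℝ, 𝔼) (extChartAt (𝓡 n) c ∘ chartInv c) y
      ((dChart c (chartInv c y)).comp (dChartInv c y)) :=
    (hasMFDerivAt_extChart (chartInv_mem_source hy)).comp y (hasMFDerivAt_chartInv hy)
  have h2 : (id : 𝔼 → 𝔼) =ᶠ[nhds y] extChartAt (𝓡 n) c ∘ chartInv c :=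
    Filter.eventually_of_mem ((isOpen_chartDom c).mem_nhds hy) fun z hz =>
      (extChartAt_chartInv hz).symm
  exact hasMFDerivAt_unique (h1.congr_of_eventuallyEq h2) (hasMFDerivAt_id _)

theorem cov_change (g : PseudoRiemannianMetric n M) {c c' : M} {y : 𝔼}
    (hy : y ∈ domOn c (extChartAt (𝓡 n) c').source) :
    g.cov c y = (jac (trans c c') y).transpose * g.cov c' (trans c c' y) * jac (trans c c') y := by
  have hfr : ∀ a : Fin n, dChartInv c y (EuclideanSpace.single a 1) = ∑ i, jac (trans c c') y i a •
      dChartInv c' (trans c c' y) (EuclideanSpace.single i 1) := by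
    intro a
    rw [dChartInv_eq_comp hy, ContinuousLinearMap.comp_apply, clm_apply_single_sum]
    exact Finset.sum_congr rfl fun i _ => by
      rw [jac, Matrix.of_apply, pd_apply (differentiableAt_trans hy)]
  ext a b
  rw [cov_apply, hfr, hfr]
  simp only [Matrix.mul_apply, Matrix.transpose_apply, cov_apply, map_sum, map_smul,
    LinearMap.sum_apply, LinearMap.smul_apply, smul_eq_mul, chartInv_trans hy, Finset.sum_mul,
    Finset.mul_sum]
  exact Finset.sum_congr rfl fun _ _ => Finset.sum_congr rfl fun _ _ => by ring

theorem SymTwoTensor.contra_change (K : SymTwoTensor n M) {c c' : M} {y : 𝔼}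
    (hy : y ∈ domOn c (extChartAt (𝓡 n) c').source) :
    K.contra c' (trans c c' y)
      = jac (trans c c') y * K.contra c y * (jac (trans c c') y).transpose := by
  have hco : ∀ i : Fin n, (EuclideanSpace.proj i : 𝔼 →L[ℝ] ℝ).comp (dChart c' (chartInv c y))
      = ∑ a, jac (trans c c') y i a •
        (EuclideanSpace.proj a : 𝔼 →L[ℝ] ℝ).comp (dChart c (chartInv c y)) := by
    intro i
    ext v
    rw [dChart_eq_comp hy]
    simp only [ContinuousLinearMap.comp_apply, _root_.sum_apply,
      _root_.smul_apply, smul_eq_mul, PiLp.proj_apply]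
    rw [clm_apply_single_sum (fderiv ℝ (trans c c') y)]
    simp only [WithLp.ofLp_sum, Finset.sum_apply, PiLp.smul_apply, smul_eq_mul, jac,
      Matrix.of_apply, pd_apply (differentiableAt_trans hy)]
    exact Finset.sum_congr rfl fun _ _ => mul_comm _ _
  ext i j
  rw [contra_apply, chartInv_trans hy, hco, hco]
  simp only [Matrix.mul_apply, Matrix.transpose_apply, contra_apply, map_sum, map_smul,
    LinearMap.sum_apply, LinearMap.smul_apply, smul_eq_mul, Finset.sum_mul, Finset.mul_sum]
  exact Finset.sum_congr rfl fun _ _ => Finset.sum_congr rfl fun _ _ => by ring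

theorem isUnit_det_cov (g : PseudoRiemannianMetric n M) {c : M} {y : 𝔼}
    (hy : y ∈ (chartDom c : Set 𝔼)) : IsUnit (g.cov c y).det := by
  rw [isUnit_iff_ne_zero]
  intro h0
  obtain ⟨v, hv, hv0⟩ := Matrix.exists_mulVec_eq_zero_iff.2 h0
  have hLD : ∀ w, dChart c (chartInv c y) (dChartInv c y w) = w := fun w => by
    have := congrArg (fun L : 𝔼 →L[ℝ] 𝔼 => L w) (dChart_comp_dChartInv hy)
    simpa using this
  have hinj : Function.Injective (dChartInv c y) := Function.LeftInverse.injective hLD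
  have hsurj : Function.Surjective (dChartInv c y) :=
    (LinearMap.injective_iff_surjective (f := (dChartInv c y : 𝔼 →ₗ[ℝ] 𝔼))).1 hinj
  set w : 𝔼 := WithLp.toLp 2 v
  have hw0 : dChartInv c y w = 0 := by
    refine g.nondegenerate (chartInv c y) (dChartInv c y w) fun u => ?_
    obtain ⟨z, rfl⟩ := hsurj u
    change g.form (chartInv c y) (dChartInv c y w) (dChartInv c y z) = 0
    rw [clm_apply_single_sum (dChartInv c y) w, clm_apply_single_sum (dChartInv c y) z]
    simp only [map_sum, map_smul, LinearMap.sum_apply, LinearMap.smul_apply, smul_eq_mul,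
      ← cov_apply]
    refine Finset.sum_eq_zero fun b _ => ?_
    have hb := congrFun hv0 b
    simp only [Matrix.mulVec, dotProduct, Pi.zero_apply] at hb
    rw [← cov_symm] at hb
    simp only [Matrix.transpose_apply] at hb
    rw [show ∑ i, w i * g.cov c y i b = 0 from by
      rw [← hb]; exact Finset.sum_congr rfl fun _ _ => mul_comm _ _, mul_zero]
  have : w = 0 := hinj (by rw [hw0, map_zero])
  exact hv (by simpa [w] using this)

/-- The components, in each chart, of a smooth symmetric contravariant two-tensor. -/
structure IsTensorField (A : M → 𝔼 → Matrix (Fin n) (Fin n) ℝ) : Prop where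
  smooth : ∀ (c : M) (a b : Fin n), ContDiffOn ℝ ∞ (fun y => A c y a b) (chartDom c)
  symm : ∀ (c : M) (y : 𝔼), (A c y).transpose = A c y
  change : ∀ {c c' : M} {y : 𝔼}, y ∈ domOn c (extChartAt (𝓡 n) c').source →
    A c' (trans c c' y) = jac (trans c c') y * A c y * (jac (trans c c') y).transpose

theorem SymTwoTensor.isTensorField (K : SymTwoTensor n M) : IsTensorField K.contra where
  smooth := K.smooth
  symm c y := by ext a b; exact K.symm _ _ _
  change hy := K.contra_change hy

theorem contDiffOn_det {ι : Type*} [Fintype ι] [DecidableEq ι] {A : 𝔼 → Matrix ι ι ℝ}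
    {s : Set 𝔼} (hA : ∀ i j, ContDiffOn ℝ ∞ (fun z => A z i j) s) :
    ContDiffOn ℝ ∞ (fun z => (A z).det) s := by
  simp only [Matrix.det_apply]
  refine ContDiffOn.sum fun σ _ => ?_
  exact (contDiffOn_prod fun i _ => hA (σ i) i).const_smul (Equiv.Perm.sign σ)

theorem contDiffOn_inv_apply {A : 𝔼 → Matrix (Fin n) (Fin n) ℝ} {s : Set 𝔼}
    (hA : ∀ i j, ContDiffOn ℝ ∞ (fun z => A z i j) s) (hdet : ∀ z ∈ s, IsUnit (A z).det)
    (i j : Fin n) : ContDiffOn ℝ ∞ (fun z => (A z)⁻¹ i j) s := by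
  have : ∀ z, (A z)⁻¹ i j = (A z).det⁻¹ * ((A z).updateRow j (Pi.single i 1)).det := by
    intro z
    rw [Matrix.inv_def, Matrix.smul_apply, Matrix.adjugate_apply, Ring.inverse_eq_inv', smul_eq_mul]
  simp only [this]
  refine ((contDiffOn_det hA).inv fun z hz => (hdet z hz).ne_zero).mul (contDiffOn_det fun k l => ?_)
  by_cases h : k = j
  · subst h
    simp only [Matrix.updateRow_self]
    exact contDiffOn_const
  · simp only [Matrix.updateRow_ne h]
    exact hA k l

theorem PseudoRiemannianMetric.isTensorField (g : PseudoRiemannianMetric n M) :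
    IsTensorField g.contra where
  smooth c a b := contDiffOn_inv_apply (g.smooth c) (fun _ hz => isUnit_det_cov g hz) a b
  symm c y := by
    rw [PseudoRiemannianMetric.contra, Matrix.transpose_nonsing_inv, cov_symm]
  change {c c' y} hy := by
    have hQ := jac_trans_mul hy
    have hPT : (jac (trans c c') y).transpose * (jac (trans c' c) (trans c c' y)).transpose = 1 := by
      rw [← Matrix.transpose_mul, hQ, Matrix.transpose_one]
    rw [PseudoRiemannianMetric.contra, PseudoRiemannianMetric.contra]
    apply Matrix.inv_eq_left_inv
    have hdet := isUnit_det_cov g hy.1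
    have hcov : g.cov c' (trans c c' y) = (jac (trans c' c) (trans c c' y)).transpose
        * g.cov c y * jac (trans c' c) (trans c c' y) := by
      rw [cov_change g (trans_mem hy), trans_trans hy]
    rw [hcov]
    calc _ = jac (trans c c') y * ((g.cov c y)⁻¹ * ((jac (trans c c') y).transpose
            * (jac (trans c' c) (trans c c' y)).transpose) * g.cov c y)
            * jac (trans c' c) (trans c c' y) := by simp only [Matrix.mul_assoc]
      _ = 1 := by
        rw [hPT, Matrix.mul_one, Matrix.nonsing_inv_mul _ hdet, Matrix.mul_one,
          mul_eq_one_comm.1 hQ]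

end Charts

/-! ### The operators `Δ_A` and their quantum modifications -/

section Operators

variable {M : Type*} [TopologicalSpace M] [ChartedSpace (EuclideanSpace ℝ (Fin n)) M]

theorem coordDiv_add {G : 𝔼 → Matrix (Fin n) (Fin n) ℝ} {X Y : 𝔼 → Fin n → ℝ} {y : 𝔼}
    (hX : ∀ a, DifferentiableAt ℝ (fun z => X z a) y)
    (hY : ∀ a, DifferentiableAt ℝ (fun z => Y z a) y) :
    coordDiv G (fun z a => X z a + Y z a) y = coordDiv G X y + coordDiv G Y y := by
  simp only [coordDiv, pd_add (hX _) (hY _), add_mul, Finset.sum_add_distrib, mul_add]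
  ring

theorem coordDiv_mul {G : 𝔼 → Matrix (Fin n) (Fin n) ℝ} {φ : 𝔼 → ℝ} {X : 𝔼 → Fin n → ℝ} {y : 𝔼}
    (hφ : DifferentiableAt ℝ φ y) (hX : ∀ a, DifferentiableAt ℝ (fun z => X z a) y) :
    coordDiv G (fun z a => φ z * X z a) y
      = φ y * coordDiv G X y + ∑ a, pd a φ y * X y a := by
  simp only [coordDiv, pd_mul hφ (hX _), Finset.sum_add_distrib, mul_add, Finset.mul_sum]
  have : ∀ d, (1 / 2) * (φ y * X y d * ((G y)⁻¹ * pdM d G y).trace)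
      = φ y * (1 / 2 * (X y d * ((G y)⁻¹ * pdM d G y).trace)) := fun d => by ring
  simp only [this]
  ring

/-- The trace `Γ^a_{ad}` of the Christoffel symbols is `½ tr(G⁻¹ ∂_d G)`, so the covariant
divergence has the coordinate expression `coordDiv`. -/
theorem sum_covDeriv_eq_coordDiv (g : PseudoRiemannianMetric n M) (c : M) (X : 𝔼 → Fin n → ℝ)
    (y : 𝔼) : ∑ a, covDeriv g c X a a y = coordDiv (g.cov c) X y := by
  have hs : ∀ a e, g.contra c y a e = g.contra c y e a := by
    intro a e
    have : (g.contra c y).transpose = g.contra c y := by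
      rw [PseudoRiemannianMetric.contra, Matrix.transpose_nonsing_inv, cov_symm]
    exact congrFun (congrFun this e) a
  have htr : ∀ d, ∑ a, christoffel g c a a d y
      = (1 / 2) * ((g.cov c y)⁻¹ * pdM d (g.cov c) y).trace := by
    intro d
    simp only [christoffel, ← Finset.mul_sum]
    congr 1
    simp only [mul_sub, mul_add, Finset.sum_sub_distrib, Finset.sum_add_distrib]
    have hswap : ∑ a, ∑ e, g.contra c y a e * pd e (fun z => g.cov c z a d) y
        = ∑ a, ∑ e, g.contra c y a e * pd a (fun z => g.cov c z e d) y := by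
      rw [Finset.sum_comm]
      exact Finset.sum_congr rfl fun a _ => Finset.sum_congr rfl fun e _ => by rw [hs]
    rw [hswap, add_sub_cancel_left]
    simp only [Matrix.trace, Matrix.diag, Matrix.mul_apply, pdM, Matrix.of_apply]
    rfl
  simp only [covDeriv, coordDiv, Finset.sum_add_distrib]
  congr 1
  rw [Finset.sum_comm]
  simp only [← Finset.sum_mul, htr, Finset.mul_sum]
  exact Finset.sum_congr rfl fun _ _ => by ring

theorem differentiableAt_cov (g : PseudoRiemannianMetric n M) {c : M} {y : 𝔼}
    (hy : y ∈ (chartDom c : Set 𝔼)) (a b : Fin n) :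
    DifferentiableAt ℝ (fun z => g.cov c z a b) y :=
  ((g.smooth c a b).contDiffAt ((isOpen_chartDom c).mem_nhds hy)).differentiableAt (by simp)

theorem laplace_eq_coordDiv (g : PseudoRiemannianMetric n M)
    (A : M → 𝔼 → Matrix (Fin n) (Fin n) ℝ) (f : M → ℝ) (x : M) :
    laplace g A f x = coordDiv (g.cov x) (tensorGrad A f x) (extChartAt (𝓡 n) x x) :=
  sum_covDeriv_eq_coordDiv g x _ _

theorem eventually_rep {f u : M → ℝ} {c : M} {y : 𝔼} (hy : y ∈ (chartDom c : Set 𝔼))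
    (h : f =ᶠ[nhds (chartInv c y)] u) :
    (fun z => f (chartInv c z)) =ᶠ[nhds y] fun z => u (chartInv c z) :=
  ((continuousOn_chartInv c).continuousAt ((isOpen_chartDom c).mem_nhds hy)).eventually h

theorem tensorGrad_congr (A : M → 𝔼 → Matrix (Fin n) (Fin n) ℝ) {f u : M → ℝ} {c : M} {y : 𝔼}
    (hy : y ∈ (chartDom c : Set 𝔼)) (h : f =ᶠ[nhds (chartInv c y)] u) :
    tensorGrad A f c y = tensorGrad A u c y := by
  funext a
  exact Finset.sum_congr rfl fun b _ => by rw [pd_congr (eventually_rep hy h)]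

theorem laplace_congr (g : PseudoRiemannianMetric n M) (A : M → 𝔼 → Matrix (Fin n) (Fin n) ℝ)
    {f u : M → ℝ} {x : M} (h : f =ᶠ[nhds x] u) : laplace g A f x = laplace g A u x := by
  have hx := extChartAt_mem_chartDom (mem_extChartAt_source (I := 𝓡 n) x)
  rw [laplace_eq_coordDiv, laplace_eq_coordDiv]
  refine coordDiv_congr ?_
  have h2 : ∀ᶠ z in nhds (chartInv x (extChartAt (𝓡 n) x x)), f =ᶠ[nhds z] u := by
    rw [chartInv_extChartAt (mem_extChartAt_source x)]
    exact h.eventually_nhds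
  filter_upwards [(isOpen_chartDom x).mem_nhds hx, ((continuousOn_chartInv x).continuousAt
    ((isOpen_chartDom x).mem_nhds hx)).eventually h2] with z hz hzu
  exact tensorGrad_congr A hz hzu

theorem quantum_congr (hbar : ℝ) (g : PseudoRiemannianMetric n M)
    (A : M → 𝔼 → Matrix (Fin n) (Fin n) ℝ) (V E : M → ℝ) {f u : M → ℝ} {x : M}
    (h : f =ᶠ[nhds x] u) : quantum hbar g A V E f =ᶠ[nhds x] quantum hbar g A V E u := by
  filter_upwards [h.eventually_nhds] with z hz
  rw [quantum, quantum, laplace_congr g A hz, hz.self_of_nhds]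

/-- The pairing `A(df, du)` at `x`, computed in the chart at `x`. -/
def gradPair (A : M → 𝔼 → Matrix (Fin n) (Fin n) ℝ) (f u : M → ℝ) (x : M) : ℝ :=
  ∑ a, tensorGrad A f x (extChartAt (𝓡 n) x x) a *
    pd a (fun z => u (chartInv x z)) (extChartAt (𝓡 n) x x)

theorem gradPair_comm {A : M → 𝔼 → Matrix (Fin n) (Fin n) ℝ} (hA : IsTensorField A)
    (f u : M → ℝ) (x : M) : gradPair A f u x = gradPair A u f x := by
  simp only [gradPair, tensorGrad, Finset.sum_mul]
  rw [Finset.sum_comm]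
  refine Finset.sum_congr rfl fun b _ => Finset.sum_congr rfl fun a _ => ?_
  have : A x (extChartAt (𝓡 n) x x) a b = A x (extChartAt (𝓡 n) x x) b a :=
    congrFun (congrFun (hA.symm x (extChartAt (𝓡 n) x x)) b) a
  rw [this]; ring

theorem gradPair_const (A : M → 𝔼 → Matrix (Fin n) (Fin n) ℝ) (f : M → ℝ) (r : ℝ) (x : M) :
    gradPair A f (fun _ => r) x = 0 := by
  simp [gradPair, pd_const]

theorem laplace_const (g : PseudoRiemannianMetric n M) (A : M → 𝔼 → Matrix (Fin n) (Fin n) ℝ)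
    (r : ℝ) (x : M) : laplace g A (fun _ => r) x = 0 := by
  have : tensorGrad A (fun _ => r) x = fun (_ : 𝔼) (_ : Fin n) => (0 : ℝ) := by
    funext z a
    simp [tensorGrad, pd_const]
  rw [laplace_eq_coordDiv, this]
  simp [coordDiv, pd_const]

variable [IsManifold (𝓡 n) ∞ M]

theorem contDiffOn_rep {f : M → ℝ} {U : Set M} (hf : ContMDiffOn (𝓡 n) 𝓘(ℝ, ℝ) ∞ f U) (c : M) :
    ContDiffOn ℝ ∞ (fun z : 𝔼 => f (chartInv c z)) (domOn c U) := by
  have h : ContMDiffOn 𝓘(ℝ, 𝔼) 𝓘(ℝ, ℝ) ∞ (f ∘ chartInv c) (domOn c U) :=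
    hf.comp (fun y hy => (contMDiffAt_chartInv hy.1).contMDiffWithinAt) fun y hy => hy.2
  exact h.contDiffOn

theorem contDiffAt_rep {f : M → ℝ} {U : Set M} (hU : IsOpen U)
    (hf : ContMDiffOn (𝓡 n) 𝓘(ℝ, ℝ) ∞ f U) {c : M} {y : 𝔼} (hy : y ∈ domOn c U) :
    ContDiffAt ℝ ∞ (fun z : 𝔼 => f (chartInv c z)) y :=
  (contDiffOn_rep hf c).contDiffAt ((isOpen_domOn c hU).mem_nhds hy)

theorem differentiableAt_rep {f : M → ℝ} {U : Set M} (hU : IsOpen U)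
    (hf : ContMDiffOn (𝓡 n) 𝓘(ℝ, ℝ) ∞ f U) {c : M} {y : 𝔼} (hy : y ∈ domOn c U) :
    DifferentiableAt ℝ (fun z : 𝔼 => f (chartInv c z)) y :=
  (contDiffAt_rep hU hf hy).differentiableAt (by simp)

theorem contMDiffOn_of_rep {f : M → ℝ} {U : Set M} (hU : IsOpen U)
    (hf : ∀ c : M, ContDiffOn ℝ ∞ (fun z : 𝔼 => f (chartInv c z)) (domOn c U)) :
    ContMDiffOn (𝓡 n) 𝓘(ℝ, ℝ) ∞ f U := by
  intro x hx
  have hd : ContDiffAt ℝ ∞ (fun z : 𝔼 => f (chartInv x z)) (extChartAt (𝓡 n) x x) :=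
    (hf x).contDiffAt ((isOpen_domOn x hU).mem_nhds (center_mem_domOn hx))
  have h1 : ContMDiffAt (𝓡 n) 𝓘(ℝ, ℝ) ∞
      ((fun z : 𝔼 => f (chartInv x z)) ∘ extChartAt (𝓡 n) x) x :=
    hd.contMDiffAt.comp x (contMDiffAt_extChart (mem_extChartAt_source x))
  refine (h1.congr_of_eventuallyEq ?_).contMDiffWithinAt
  exact Filter.eventually_of_mem (extChartAt_source_mem_nhds (I := 𝓡 n) x) fun z hz => by
    simp only [Function.comp, chartInv_extChartAt hz]

theorem contDiffOn_tensorGrad {A : M → 𝔼 → Matrix (Fin n) (Fin n) ℝ} (hA : IsTensorField A)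
    {f : M → ℝ} {U : Set M} (hU : IsOpen U) (hf : ContMDiffOn (𝓡 n) 𝓘(ℝ, ℝ) ∞ f U) (c : M)
    (a : Fin n) : ContDiffOn ℝ ∞ (fun z => tensorGrad A f c z a) (domOn c U) :=
  ContDiffOn.sum fun b _ => ((hA.smooth c a b).mono Set.inter_subset_left).mul
    (contDiffOn_pd (isOpen_domOn c hU) (contDiffOn_rep hf c) b)

theorem differentiableAt_tensorGrad {A : M → 𝔼 → Matrix (Fin n) (Fin n) ℝ} (hA : IsTensorField A)
    {f : M → ℝ} {U : Set M} (hU : IsOpen U) (hf : ContMDiffOn (𝓡 n) 𝓘(ℝ, ℝ) ∞ f U) {c : M}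
    {y : 𝔼} (hy : y ∈ domOn c U) (a : Fin n) :
    DifferentiableAt ℝ (fun z => tensorGrad A f c z a) y :=
  ((contDiffOn_tensorGrad hA hU hf c a).contDiffAt
    ((isOpen_domOn c hU).mem_nhds hy)).differentiableAt (by simp)

/-- The transformation law `∂_b f = (∂_b τ^i) ∂'_i f` of the differential of a function. -/
theorem pd_rep_change {f : M → ℝ} {U : Set M} (hU : IsOpen U)
    (hf : ContMDiffOn (𝓡 n) 𝓘(ℝ, ℝ) ∞ f U) {c c' : M} {y : 𝔼}
    (hy : y ∈ domOn c (extChartAt (𝓡 n) c').source) (hyU : chartInv c y ∈ U) (b : Fin n) :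
    pd b (fun z => f (chartInv c z)) y
      = ∑ i, jac (trans c c') y i b * pd i (fun z => f (chartInv c' z)) (trans c c' y) := by
  have h1 : (fun z => f (chartInv c z)) =ᶠ[nhds y] fun z => f (chartInv c' (trans c c' z)) :=
    Filter.eventually_of_mem (overlap_mem_nhds hy) fun z hz => by
      simp only [chartInv_trans hz]
  have hτU : trans c c' y ∈ domOn c' U :=
    ⟨(trans_mem hy).1, by rwa [Set.mem_preimage, chartInv_trans hy]⟩
  rw [pd_congr h1]
  exact pd_comp (u := fun z => f (chartInv c' z)) (differentiableAt_rep hU hf hτU)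
    (differentiableAt_trans hy) b

theorem tensorGrad_change {A : M → 𝔼 → Matrix (Fin n) (Fin n) ℝ} (hA : IsTensorField A)
    {f : M → ℝ} {U : Set M} (hU : IsOpen U) (hf : ContMDiffOn (𝓡 n) 𝓘(ℝ, ℝ) ∞ f U) {c c' : M}
    {y : 𝔼} (hy : y ∈ domOn c (extChartAt (𝓡 n) c').source) (hyU : chartInv c y ∈ U) :
    tensorGrad A f c' (trans c c' y)
      = (jac (trans c c') y).mulVec (tensorGrad A f c y) := by
  have h1 : tensorGrad A f c' (trans c c' y) = (A c' (trans c c' y)).mulVec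
      (fun i => pd i (fun z => f (chartInv c' z)) (trans c c' y)) := rfl
  have h2 : tensorGrad A f c y = (A c y).mulVec
      ((jac (trans c c') y).transpose.mulVec
        (fun i => pd i (fun z => f (chartInv c' z)) (trans c c' y))) := by
    funext a
    exact Finset.sum_congr rfl fun b _ => by rw [pd_rep_change hU hf hy hyU]; rfl
  rw [h1, h2, hA.change hy, Matrix.mulVec_mulVec, Matrix.mulVec_mulVec, Matrix.mul_assoc]

/-- An equality of two vector fields `A∇f` and `B∇u` at a point may be checked in any chart. -/
theorem tensorGrad_eq_of_eq {A B : M → 𝔼 → Matrix (Fin n) (Fin n) ℝ} (hA : IsTensorField A)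
    (hB : IsTensorField B) {f u : M → ℝ} {U : Set M} (hU : IsOpen U)
    (hf : ContMDiffOn (𝓡 n) 𝓘(ℝ, ℝ) ∞ f U) (hu : ContMDiffOn (𝓡 n) 𝓘(ℝ, ℝ) ∞ u U) {c c' : M}
    {y : 𝔼} (hy : y ∈ domOn c (extChartAt (𝓡 n) c').source) (hyU : chartInv c y ∈ U)
    (h : tensorGrad A f c' (trans c c' y) = tensorGrad B u c' (trans c c' y)) :
    tensorGrad A f c y = tensorGrad B u c y := by
  rw [tensorGrad_change hA hU hf hy hyU, tensorGrad_change hB hU hu hy hyU] at h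
  have := congrArg (jac (trans c' c) (trans c c' y)).mulVec h
  simpa only [Matrix.mulVec_mulVec, jac_trans_mul hy, Matrix.one_mulVec] using this

/-- `Δ_A f`, which is defined at each point through the chart at that point, can be computed in
any chart. -/
theorem laplace_chartInv (g : PseudoRiemannianMetric n M)
    {A : M → 𝔼 → Matrix (Fin n) (Fin n) ℝ} (hA : IsTensorField A) {f : M → ℝ} {U : Set M}
    (hU : IsOpen U) (hf : ContMDiffOn (𝓡 n) 𝓘(ℝ, ℝ) ∞ f U) {c : M} {y : 𝔼}
    (hy : y ∈ domOn c U) :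
    laplace g A f (chartInv c y) = coordDiv (g.cov c) (tensorGrad A f c) y := by
  set x := chartInv c y with hx
  have hyx : y ∈ domOn c (extChartAt (𝓡 n) x).source := ⟨hy.1, mem_extChartAt_source x⟩
  have hτU : trans c x y ∈ domOn x U :=
    ⟨(trans_mem hyx).1, by rw [Set.mem_preimage, chartInv_trans hyx]; exact hy.2⟩
  rw [laplace_eq_coordDiv]
  symm
  refine coordDiv_change (τ := trans c x) (contDiffAt_trans hyx) (jac_trans_mul hyx)
    (differentiableAt_cov g hτU.1) (isUnit_det_cov g hτU.1) ?_
    (differentiableAt_tensorGrad hA hU hf hy) (differentiableAt_tensorGrad hA hU hf hτU) ?_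
  · exact Filter.eventually_of_mem (overlap_mem_nhds hyx) fun z hz => cov_change g hz
  · filter_upwards [overlap_mem_nhds hyx, (isOpen_domOn c hU).mem_nhds hy] with z hz hzU
    exact tensorGrad_change hA hU hf hz hzU.2

theorem contDiffOn_coordDiv (g : PseudoRiemannianMetric n M) {c : M} {s : Set 𝔼} (hs : IsOpen s)
    (hsc : s ⊆ chartDom c) {X : 𝔼 → Fin n → ℝ} (hX : ∀ a, ContDiffOn ℝ ∞ (fun z => X z a) s) :
    ContDiffOn ℝ ∞ (coordDiv (g.cov c) X) s := by
  refine (ContDiffOn.sum fun a _ => contDiffOn_pd hs (hX a) a).add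
    (contDiffOn_const.mul (ContDiffOn.sum fun d _ => (hX d).mul ?_))
  simp only [Matrix.trace, Matrix.diag, Matrix.mul_apply]
  exact ContDiffOn.sum fun a _ => ContDiffOn.sum fun b _ =>
    ((g.isTensorField.smooth c a b).mono hsc).mul
      (contDiffOn_pd hs ((g.smooth c b a).mono hsc) d)

theorem contMDiffOn_laplace (g : PseudoRiemannianMetric n M)
    {A : M → 𝔼 → Matrix (Fin n) (Fin n) ℝ} (hA : IsTensorField A) {f : M → ℝ} {U : Set M}
    (hU : IsOpen U) (hf : ContMDiffOn (𝓡 n) 𝓘(ℝ, ℝ) ∞ f U) :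
    ContMDiffOn (𝓡 n) 𝓘(ℝ, ℝ) ∞ (laplace g A f) U := by
  refine contMDiffOn_of_rep hU fun c => ?_
  refine (contDiffOn_coordDiv g (isOpen_domOn c hU) Set.inter_subset_left
    (contDiffOn_tensorGrad hA hU hf c)).congr fun y hy => laplace_chartInv g hA hU hf hy

theorem laplace_mul (g : PseudoRiemannianMetric n M)
    {A : M → 𝔼 → Matrix (Fin n) (Fin n) ℝ} (hA : IsTensorField A) {f u : M → ℝ} {U : Set M}
    (hU : IsOpen U) (hf : ContMDiffOn (𝓡 n) 𝓘(ℝ, ℝ) ∞ f U) (hu : ContMDiffOn (𝓡 n) 𝓘(ℝ, ℝ) ∞ u U)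
    {x : M} (hx : x ∈ U) :
    laplace g A (fun z => f z * u z) x
      = f x * laplace g A u x + u x * laplace g A f x + 2 * gradPair A f u x := by
  have hy := center_mem_domOn (n := n) hx
  have hxx := chartInv_extChartAt (mem_extChartAt_source (I := 𝓡 n) x)
  have h1 : tensorGrad A (fun z => f z * u z) x =ᶠ[nhds (extChartAt (𝓡 n) x x)]
      fun z a => f (chartInv x z) * tensorGrad A u x z a
        + u (chartInv x z) * tensorGrad A f x z a := by
    filter_upwards [(isOpen_domOn x hU).mem_nhds hy] with z hz
    funext a
    simp only [tensorGrad, Finset.mul_sum, ← Finset.sum_add_distrib,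
      pd_mul (differentiableAt_rep hU hf hz) (differentiableAt_rep hU hu hz)]
    exact Finset.sum_congr rfl fun _ _ => by ring
  have hf' := differentiableAt_rep hU hf hy
  have hu' := differentiableAt_rep hU hu hy
  have hgf := differentiableAt_tensorGrad hA hU hf hy
  have hgu := differentiableAt_tensorGrad hA hU hu hy
  rw [laplace_eq_coordDiv, coordDiv_congr h1, coordDiv_add (fun a => hf'.fun_mul (hgu a))
    (fun a => hu'.fun_mul (hgf a)), coordDiv_mul hf' hgu, coordDiv_mul hu' hgf,
    ← laplace_eq_coordDiv, ← laplace_eq_coordDiv, hxx]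
  have e1 : ∑ a, pd a (fun z => u (chartInv x z)) (extChartAt (𝓡 n) x x)
      * tensorGrad A f x (extChartAt (𝓡 n) x x) a = gradPair A f u x :=
    Finset.sum_congr rfl fun _ _ => mul_comm _ _
  have e2 : ∑ a, pd a (fun z => f (chartInv x z)) (extChartAt (𝓡 n) x x)
      * tensorGrad A u x (extChartAt (𝓡 n) x x) a = gradPair A f u x := by
    rw [gradPair_comm hA]
    exact Finset.sum_congr rfl fun _ _ => mul_comm _ _
  rw [e1, e2]; ring

theorem laplace_add (g : PseudoRiemannianMetric n M)
    {A : M → 𝔼 → Matrix (Fin n) (Fin n) ℝ} (hA : IsTensorField A) {f u : M → ℝ} {U : Set M}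
    (hU : IsOpen U) (hf : ContMDiffOn (𝓡 n) 𝓘(ℝ, ℝ) ∞ f U) (hu : ContMDiffOn (𝓡 n) 𝓘(ℝ, ℝ) ∞ u U)
    {x : M} (hx : x ∈ U) :
    laplace g A (fun z => f z + u z) x = laplace g A f x + laplace g A u x := by
  have hy := center_mem_domOn (n := n) hx
  have h1 : tensorGrad A (fun z => f z + u z) x =ᶠ[nhds (extChartAt (𝓡 n) x x)]
      fun z a => tensorGrad A f x z a + tensorGrad A u x z a := by
    filter_upwards [(isOpen_domOn x hU).mem_nhds hy] with z hz
    funext a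
    simp only [tensorGrad, ← Finset.sum_add_distrib, ← mul_add,
      pd_add (differentiableAt_rep hU hf hz) (differentiableAt_rep hU hu hz)]
  rw [laplace_eq_coordDiv, coordDiv_congr h1,
    coordDiv_add (differentiableAt_tensorGrad hA hU hf hy) (differentiableAt_tensorGrad hA hU hu hy),
    ← laplace_eq_coordDiv, ← laplace_eq_coordDiv]

theorem laplace_const_mul (g : PseudoRiemannianMetric n M)
    {A : M → 𝔼 → Matrix (Fin n) (Fin n) ℝ} (hA : IsTensorField A) {u : M → ℝ} {U : Set M}
    (hU : IsOpen U) (hu : ContMDiffOn (𝓡 n) 𝓘(ℝ, ℝ) ∞ u U) (r : ℝ) {x : M} (hx : x ∈ U) :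
    laplace g A (fun z => r * u z) x = r * laplace g A u x := by
  rw [laplace_mul g hA hU contMDiffOn_const hu hx, laplace_const, gradPair_comm hA, gradPair_const]
  ring

theorem contMDiffOn_quantum (hbar : ℝ) (g : PseudoRiemannianMetric n M)
    {A : M → 𝔼 → Matrix (Fin n) (Fin n) ℝ} (hA : IsTensorField A) {V E ψ : M → ℝ} {U : Set M}
    (hU : IsOpen U) (hV : ContMDiffOn (𝓡 n) 𝓘(ℝ, ℝ) ∞ V U) (hE : ContMDiffOn (𝓡 n) 𝓘(ℝ, ℝ) ∞ E U)
    (hψ : ContMDiffOn (𝓡 n) 𝓘(ℝ, ℝ) ∞ ψ U) :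
    ContMDiffOn (𝓡 n) 𝓘(ℝ, ℝ) ∞ (quantum hbar g A V E ψ) U :=
  (contMDiffOn_const.mul ((contMDiffOn_laplace g hA hU hψ).add (hE.mul hψ))).add (hV.mul hψ)

theorem quantum_add_const_mul (hbar : ℝ) (g : PseudoRiemannianMetric n M)
    {A : M → 𝔼 → Matrix (Fin n) (Fin n) ℝ} (hA : IsTensorField A) (V E : M → ℝ) {u v : M → ℝ}
    {U : Set M} (hU : IsOpen U) (hu : ContMDiffOn (𝓡 n) 𝓘(ℝ, ℝ) ∞ u U)
    (hv : ContMDiffOn (𝓡 n) 𝓘(ℝ, ℝ) ∞ v U) (r : ℝ) {x : M} (hx : x ∈ U) :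
    quantum hbar g A V E (fun z => u z + r * v z) x
      = quantum hbar g A V E u x + r * quantum hbar g A V E v x := by
  rw [quantum, laplace_add g hA hU hu (u := fun z => r * v z) (contMDiffOn_const.mul hv) hx,
    laplace_const_mul g hA hU hv r hx, quantum, quantum]
  ring

/-- The commutator of `-(ħ²/2)(Δ_A + E) + V` with multiplication by `f` is the first-order operator
`-(ħ²/2)(2 A(df, d·) + Δ_A f)`. -/
theorem quantum_mul (hbar : ℝ) (g : PseudoRiemannianMetric n M)
    {A : M → 𝔼 → Matrix (Fin n) (Fin n) ℝ} (hA : IsTensorField A) (V E : M → ℝ) {f ψ : M → ℝ}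
    {U : Set M} (hU : IsOpen U) (hf : ContMDiffOn (𝓡 n) 𝓘(ℝ, ℝ) ∞ f U)
    (hψ : ContMDiffOn (𝓡 n) 𝓘(ℝ, ℝ) ∞ ψ U) {x : M} (hx : x ∈ U) :
    quantum hbar g A V E (fun z => f z * ψ z) x = f x * quantum hbar g A V E ψ x
      - hbar ^ 2 / 2 * (ψ x * laplace g A f x + 2 * gradPair A f ψ x) := by
  rw [quantum, laplace_mul g hA hU hf hψ hx, quantum]
  ring

end Operators

/-! ### The commutator, the one-forms `K∇f` and their local potentials -/

section Commutator

variable {M : Type*} [TopologicalSpace M] [ChartedSpace (EuclideanSpace ℝ (Fin n)) M]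

theorem isPotentialOn_congr {θ : M → 𝔼 → Fin n → ℝ} {f u : M → ℝ} {U : Set M} (hU : IsOpen U)
    (h : IsPotentialOn f θ U) (hfu : Set.EqOn u f U) : IsPotentialOn u θ U := by
  refine ⟨h.1.congr hfu, fun c y hy hyU a => ?_⟩
  rw [← h.2 c y hy hyU a]
  exact pd_congr (eventually_rep hy (hfu.eventuallyEq_of_mem (hU.mem_nhds hyU))) a

variable [IsManifold (𝓡 n) ∞ M]

/-- A smooth function on an open set agrees near each of its points with a globally smooth one,
obtained by multiplication with a bump function. -/
theorem exists_contMDiff_eventuallyEq [T2Space M] {ψ : M → ℝ} {U : Set M} (hU : IsOpen U)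
    (hψ : ContMDiffOn (𝓡 n) 𝓘(ℝ, ℝ) ∞ ψ U) {x : M} (hx : x ∈ U) :
    ∃ φ : M → ℝ, ContMDiff (𝓡 n) 𝓘(ℝ, ℝ) ∞ φ ∧ φ =ᶠ[nhds x] ψ := by
  obtain ⟨f, hf, -⟩ := (SmoothBumpFunction.nhds_basis_support (I := 𝓡 n)
    (hU.mem_nhds hx)).mem_iff.1 (hU.mem_nhds hx)
  refine ⟨fun z => f z * ψ z, contMDiff_of_tsupport fun z hz => ?_, ?_⟩
  · exact f.contMDiffAt.mul (hψ.contMDiffAt (hU.mem_nhds (hf (tsupport_mul_subset_left hz))))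
  · filter_upwards [f.eventuallyEq_one] with z hz
    rw [hz, Pi.one_apply, one_mul]

/-- Commutation on `M`, which is tested on globally smooth functions only, restricts to open subsets
because the operators are local. -/
theorem QuantumCommuteOn.mono [T2Space M] {hbar : ℝ} {g : PseudoRiemannianMetric n M}
    {V E : M → ℝ} {K : SymTwoTensor n M} {VK F : M → ℝ}
    (h : QuantumCommuteOn hbar g V E K VK F Set.univ) {U : Set M} (hU : IsOpen U) :
    QuantumCommuteOn hbar g V E K VK F U := by
  intro ψ hψ x hx
  obtain ⟨φ, hφ, hφψ⟩ := exists_contMDiff_eventuallyEq hU hψ hx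
  have := h φ hφ.contMDiffOn x trivial
  rwa [(quantum_congr hbar g _ _ _ (quantum_congr hbar g _ _ _ hφψ)).eq_of_nhds,
    (quantum_congr hbar g _ _ _ (quantum_congr hbar g _ _ _ hφψ)).eq_of_nhds] at this

/-- Passing from the commuting pair with corrections `E₀`, `F₀` to the corrections `E`, `W` changes
the commutator by the first-order operator `(ħ⁴/4)([Δ, W - F₀] - [Δ_K, E - E₀])`. -/
theorem quantum_commutator {hbar : ℝ} {g : PseudoRiemannianMetric n M}
    {V E₀ E : M → ℝ} {K : SymTwoTensor n M} {VK F₀ W : M → ℝ} {U : Set M} (hU : IsOpen U)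
    (hV : ContMDiffOn (𝓡 n) 𝓘(ℝ, ℝ) ∞ V U) (hVK : ContMDiffOn (𝓡 n) 𝓘(ℝ, ℝ) ∞ VK U)
    (hE₀ : ContMDiffOn (𝓡 n) 𝓘(ℝ, ℝ) ∞ E₀ U) (hE : ContMDiffOn (𝓡 n) 𝓘(ℝ, ℝ) ∞ E U)
    (hF₀ : ContMDiffOn (𝓡 n) 𝓘(ℝ, ℝ) ∞ F₀ U) (hW : ContMDiffOn (𝓡 n) 𝓘(ℝ, ℝ) ∞ W U)
    (h : QuantumCommuteOn hbar g V E₀ K VK F₀ U) {ψ : M → ℝ}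
    (hψ : ContMDiffOn (𝓡 n) 𝓘(ℝ, ℝ) ∞ ψ U) {x : M} (hx : x ∈ U) :
    quantum hbar g g.contra V E (quantum hbar g K.contra VK W ψ) x
        - quantum hbar g K.contra VK W (quantum hbar g g.contra V E ψ) x
      = (hbar ^ 2 / 2) ^ 2 *
        ((ψ x * laplace g g.contra (fun z => W z - F₀ z) x
            + 2 * gradPair g.contra (fun z => W z - F₀ z) ψ x)
          - (ψ x * laplace g K.contra (fun z => E z - E₀ z) x
            + 2 * gradPair K.contra (fun z => E z - E₀ z) ψ x)) := by
  have hg := g.isTensorField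
  have hK := K.isTensorField
  have hE' : ContMDiffOn (𝓡 n) 𝓘(ℝ, ℝ) ∞ (fun z => E z - E₀ z) U := hE.sub hE₀
  have hF' : ContMDiffOn (𝓡 n) 𝓘(ℝ, ℝ) ∞ (fun z => W z - F₀ z) U := hW.sub hF₀
  have hH : ∀ (u : M → ℝ) (z : M), quantum hbar g g.contra V E u z
      = quantum hbar g g.contra V E₀ u z + -(hbar ^ 2 / 2) * ((E z - E₀ z) * u z) := by
    intro u z; simp only [quantum]; ring
  have hKW : ∀ (u : M → ℝ) (z : M), quantum hbar g K.contra VK W u z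
      = quantum hbar g K.contra VK F₀ u z + -(hbar ^ 2 / 2) * ((W z - F₀ z) * u z) := by
    intro u z; simp only [quantum]; ring
  have hHψ := contMDiffOn_quantum hbar g hg hU hV hE₀ hψ
  have hKψ := contMDiffOn_quantum hbar g hK hU hVK hF₀ hψ
  rw [hH, hKW ψ, hKW, hH ψ, funext (hKW ψ), funext (hH ψ),
    quantum_add_const_mul hbar g hg V E₀ hU hKψ (v := fun z => (W z - F₀ z) * ψ z)
      (hF'.mul hψ) _ hx,
    quantum_add_const_mul hbar g hK VK F₀ hU hHψ (v := fun z => (E z - E₀ z) * ψ z)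
      (hE'.mul hψ) _ hx,
    quantum_mul hbar g hg V E₀ hU hF' hψ hx, quantum_mul hbar g hK VK F₀ hU hE' hψ hx, h ψ hψ x hx]
  ring

/-- A globally smooth function that has, at `x`, the same derivatives as the `b`-th coordinate of the
chart at `x`. -/
theorem exists_smooth_pd_eq [T2Space M] (x : M) (b : Fin n) : ∃ φ : M → ℝ,
    ContMDiff (𝓡 n) 𝓘(ℝ, ℝ) ∞ φ ∧ ∀ a : Fin n,
      pd a (fun z => φ (chartInv x z)) (extChartAt (𝓡 n) x x) = if a = b then 1 else 0 := by
  have hs : ContMDiffOn (𝓡 n) 𝓘(ℝ, ℝ) ∞ (fun z => extChartAt (𝓡 n) x z b)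
      (extChartAt (𝓡 n) x).source := fun z hz =>
    (((EuclideanSpace.proj b : 𝔼 →L[ℝ] ℝ).contMDiff.contMDiffAt).comp z
      (contMDiffAt_extChart hz)).contMDiffWithinAt
  obtain ⟨φ, hφ, hφe⟩ := exists_contMDiff_eventuallyEq (isOpen_extChartAt_source x) hs
    (mem_extChartAt_source x)
  refine ⟨φ, hφ, fun a => ?_⟩
  have hx := extChartAt_mem_chartDom (mem_extChartAt_source (I := 𝓡 n) x)
  have hφc : φ =ᶠ[nhds (chartInv x (extChartAt (𝓡 n) x x))]
      fun z => extChartAt (𝓡 n) x z b := by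
    rwa [chartInv_extChartAt (mem_extChartAt_source x)]
  have h1 : (fun z => φ (chartInv x z)) =ᶠ[nhds (extChartAt (𝓡 n) x x)] fun z : 𝔼 => z b := by
    filter_upwards [eventually_rep hx hφc, (isOpen_chartDom x).mem_nhds hx] with z hz hzd
    rw [hz, extChartAt_chartInv hzd]
  rw [pd_congr h1, pd_apply (τ := fun z => z) differentiableAt_fun_id]
  simp [eq_comm]

/-- The operators with corrections `E`, `W` commute exactly when the vector fields
`g⁻¹ d(W - F₀)` and `K d(E - E₀)` agree. -/
theorem quantumCommuteOn_iff_tensorGrad_eq [T2Space M] {hbar : ℝ} (hbar_ne : hbar ≠ 0)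
    {g : PseudoRiemannianMetric n M}
    {V E₀ E : M → ℝ} {K : SymTwoTensor n M} {VK F₀ W : M → ℝ} {U : Set M} (hU : IsOpen U)
    (hV : ContMDiffOn (𝓡 n) 𝓘(ℝ, ℝ) ∞ V U) (hVK : ContMDiffOn (𝓡 n) 𝓘(ℝ, ℝ) ∞ VK U)
    (hE₀ : ContMDiffOn (𝓡 n) 𝓘(ℝ, ℝ) ∞ E₀ U) (hE : ContMDiffOn (𝓡 n) 𝓘(ℝ, ℝ) ∞ E U)
    (hF₀ : ContMDiffOn (𝓡 n) 𝓘(ℝ, ℝ) ∞ F₀ U) (hW : ContMDiffOn (𝓡 n) 𝓘(ℝ, ℝ) ∞ W U)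
    (h : QuantumCommuteOn hbar g V E₀ K VK F₀ U) :
    QuantumCommuteOn hbar g V E K VK W U ↔ ∀ (c : M), ∀ y ∈ (domOn c U : Set 𝔼),
      tensorGrad g.contra (fun z => W z - F₀ z) c y
        = tensorGrad K.contra (fun z => E z - E₀ z) c y := by
  have hg := g.isTensorField
  have hK := K.isTensorField
  have hE' : ContMDiffOn (𝓡 n) 𝓘(ℝ, ℝ) ∞ (fun z => E z - E₀ z) U := hE.sub hE₀
  have hF' : ContMDiffOn (𝓡 n) 𝓘(ℝ, ℝ) ∞ (fun z => W z - F₀ z) U := hW.sub hF₀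
  have hb : (hbar ^ 2 / 2) ^ 2 ≠ 0 := by positivity
  constructor
  · intro hc
    have key : ∀ ψ : M → ℝ, ContMDiffOn (𝓡 n) 𝓘(ℝ, ℝ) ∞ ψ U → ∀ x ∈ U,
        ψ x * laplace g g.contra (fun z => W z - F₀ z) x
            + 2 * gradPair g.contra (fun z => W z - F₀ z) ψ x
          = ψ x * laplace g K.contra (fun z => E z - E₀ z) x
            + 2 * gradPair K.contra (fun z => E z - E₀ z) ψ x := by
      intro ψ hψ x hx
      have := quantum_commutator hU hV hVK hE₀ hE hF₀ hW h hψ hx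
      rw [hc ψ hψ x hx, sub_self] at this
      exact sub_eq_zero.1 ((mul_eq_zero.1 this.symm).resolve_left hb)
    intro c y hy
    set x := chartInv c y with hx
    have hyx : y ∈ domOn c (extChartAt (𝓡 n) x).source := ⟨hy.1, mem_extChartAt_source x⟩
    refine tensorGrad_eq_of_eq hg hK hU hF' hE' hyx hy.2 ?_
    -- the constant function `1` isolates the zeroth-order part
    have h1 := key (fun _ => 1) contMDiffOn_const x hy.2
    rw [gradPair_const, gradPair_const, one_mul, one_mul, mul_zero, add_zero, add_zero] at h1
    funext b
    obtain ⟨φ, hφ, hφd⟩ := exists_smooth_pd_eq x b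
    have h2 := key φ hφ.contMDiffOn x hy.2
    rw [h1, add_right_inj] at h2
    have h3 := mul_left_cancel₀ two_ne_zero h2
    simp only [gradPair, hφd, mul_ite, mul_one, mul_zero, Finset.sum_ite_eq', Finset.mem_univ,
      if_true] at h3
    exact h3
  · intro ht ψ hψ x hx
    have hcx := center_mem_domOn (n := n) hx
    have e1 : laplace g g.contra (fun z => W z - F₀ z) x
        = laplace g K.contra (fun z => E z - E₀ z) x := by
      rw [laplace_eq_coordDiv, laplace_eq_coordDiv]
      exact coordDiv_congr (Filter.eventually_of_mem ((isOpen_domOn x hU).mem_nhds hcx) (ht x))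
    have e2 : gradPair g.contra (fun z => W z - F₀ z) ψ x
        = gradPair K.contra (fun z => E z - E₀ z) ψ x := by
      rw [gradPair, gradPair, ht x _ hcx]
    have := quantum_commutator hU hV hVK hE₀ hE hF₀ hW h hψ hx
    rw [e1, e2, sub_self, mul_zero] at this
    exact sub_eq_zero.1 this

/-- Raising the index turns the equation `df = K∇u` of one-forms into the equation
`g⁻¹ df = K du` of vector fields. -/
theorem isPotentialOn_iff_tensorGrad_eq {g : PseudoRiemannianMetric n M} {K : SymTwoTensor n M}
    {f u : M → ℝ} {U : Set M} (hf : ContMDiffOn (𝓡 n) 𝓘(ℝ, ℝ) ∞ f U) :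
    IsPotentialOn f (gradForm g K u) U ↔ ∀ (c : M), ∀ y ∈ (domOn c U : Set 𝔼),
      tensorGrad g.contra f c y = tensorGrad K.contra u c y := by
  have key : ∀ (c : M), ∀ y ∈ (domOn c U : Set 𝔼),
      ((∀ a, pd a (fun z => f (chartInv c z)) y = gradForm g K u c y a) ↔
        tensorGrad g.contra f c y = tensorGrad K.contra u c y) := by
    intro c y hy
    have hdet := isUnit_det_cov g hy.1
    have e1 : gradForm g K u c y = (g.cov c y).mulVec (tensorGrad K.contra u c y) := rfl
    have e2 : tensorGrad g.contra f c y
        = (g.cov c y)⁻¹.mulVec (fun a => pd a (fun z => f (chartInv c z)) y) := rfl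
    rw [← funext_iff, e1, e2]
    constructor
    · intro h
      rw [h, Matrix.mulVec_mulVec, Matrix.nonsing_inv_mul _ hdet, Matrix.one_mulVec]
    · intro h
      rw [← h, Matrix.mulVec_mulVec, Matrix.mul_nonsing_inv _ hdet, Matrix.one_mulVec]
  exact ⟨fun h c y hy => (key c y hy).1 (h.2 c y hy.1 hy.2),
    fun h => ⟨hf, fun c y hy hyU => (key c y ⟨hy, hyU⟩).2 (h c y ⟨hy, hyU⟩)⟩⟩

theorem contDiffOn_gradForm (g : PseudoRiemannianMetric n M) (K : SymTwoTensor n M) {u : M → ℝ}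
    (hu : ContMDiff (𝓡 n) 𝓘(ℝ, ℝ) ∞ u) (c : M) (a : Fin n) :
    ContDiffOn ℝ ∞ (fun y => gradForm g K u c y a) (chartDom c) :=
  ContDiffOn.sum fun b _ => (g.smooth c a b).mul (by
    have := contDiffOn_tensorGrad K.isTensorField isOpen_univ hu.contMDiffOn c b
    rwa [domOn_univ] at this)

theorem gradForm_sub (g : PseudoRiemannianMetric n M) (K : SymTwoTensor n M) {u v : M → ℝ}
    (hu : ContMDiff (𝓡 n) 𝓘(ℝ, ℝ) ∞ u) (hv : ContMDiff (𝓡 n) 𝓘(ℝ, ℝ) ∞ v) (c : M) {y : 𝔼}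
    (hy : y ∈ (chartDom c : Set 𝔼)) (a : Fin n) :
    gradForm g K (fun x => u x - v x) c y a = gradForm g K u c y a - gradForm g K v c y a := by
  rw [← domOn_univ] at hy
  simp only [gradForm, tensorGrad, pd_sub (differentiableAt_rep isOpen_univ hu.contMDiffOn hy)
    (differentiableAt_rep isOpen_univ hv.contMDiffOn hy), mul_sub, Finset.sum_sub_distrib]

theorem extD_gradForm_sub (g : PseudoRiemannianMetric n M) (K : SymTwoTensor n M) {u v : M → ℝ}
    (hu : ContMDiff (𝓡 n) 𝓘(ℝ, ℝ) ∞ u) (hv : ContMDiff (𝓡 n) 𝓘(ℝ, ℝ) ∞ v) (c : M) {y : 𝔼}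
    (hy : y ∈ (chartDom c : Set 𝔼)) (a b : Fin n) :
    extD (gradForm g K (fun x => u x - v x) c) a b y
      = extD (gradForm g K u c) a b y - extD (gradForm g K v c) a b y := by
  have hd : ∀ {w : M → ℝ}, ContMDiff (𝓡 n) 𝓘(ℝ, ℝ) ∞ w → ∀ a : Fin n,
      DifferentiableAt ℝ (fun z => gradForm g K w c z a) y := fun hw a =>
    ((contDiffOn_gradForm g K hw c a).contDiffAt
      ((isOpen_chartDom c).mem_nhds hy)).differentiableAt (by simp)
  have he : ∀ a : Fin n, (fun z => gradForm g K (fun x => u x - v x) c z a)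
      =ᶠ[nhds y] fun z => gradForm g K u c z a - gradForm g K v c z a := fun a =>
    Filter.eventually_of_mem ((isOpen_chartDom c).mem_nhds hy)
      fun z hz => gradForm_sub g K hu hv c hz a
  simp only [extD, pd_congr (he _), pd_sub (hd hu _) (hd hv _)]
  ring

theorem sameExtD_iff_isClosedForm (g : PseudoRiemannianMetric n M) (K : SymTwoTensor n M)
    {u v : M → ℝ} (hu : ContMDiff (𝓡 n) 𝓘(ℝ, ℝ) ∞ u) (hv : ContMDiff (𝓡 n) 𝓘(ℝ, ℝ) ∞ v) :
    SameExtD (gradForm g K v) (gradForm g K u) ↔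
      IsClosedForm (gradForm g K (fun x => u x - v x)) := by
  refine forall_congr' fun c => forall₂_congr fun y hy => forall₂_congr fun a b => ?_
  rw [extD_gradForm_sub g K hu hv c hy, sub_eq_zero, eq_comm]

theorem extD_eq_zero_of_isPotentialOn {θ : M → 𝔼 → Fin n → ℝ} {f : M → ℝ} {U : Set M}
    (hU : IsOpen U) (h : IsPotentialOn f θ U) {c : M} {y : 𝔼} (hy : y ∈ (domOn c U : Set 𝔼))
    (a b : Fin n) : extD (θ c) a b y = 0 := by
  have he : ∀ a : Fin n, (fun z => θ c z a) =ᶠ[nhds y]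
      fun z => pd a (fun w => f (chartInv c w)) z := fun a =>
    Filter.eventually_of_mem ((isOpen_domOn c hU).mem_nhds hy)
      fun z hz => (h.2 c z hz.1 hz.2 a).symm
  rw [extD, pd_congr (he b), pd_congr (he a), pd_comm (contDiffAt_rep hU h.1 hy), sub_self]

/-- A closed one-form `K∇u` has a potential near every point: the Poincaré lemma on a ball in a
chart. -/
theorem exists_isPotentialOn_nhds (g : PseudoRiemannianMetric n M) (K : SymTwoTensor n M)
    {u : M → ℝ} (hu : ContMDiff (𝓡 n) 𝓘(ℝ, ℝ) ∞ u) (h : IsClosedForm (gradForm g K u)) (x : M) :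
    ∃ U : Set M, IsOpen U ∧ x ∈ U ∧ ∃ f : M → ℝ, IsPotentialOn f (gradForm g K u) U := by
  have hx := extChartAt_mem_chartDom (mem_extChartAt_source (I := 𝓡 n) x)
  obtain ⟨r, hr, hB⟩ := Metric.isOpen_iff.1 (isOpen_chartDom x) _ hx
  set B := Metric.ball (extChartAt (𝓡 n) x x) r with hBdef
  set η : 𝔼 → 𝔼 →L[ℝ] ℝ := fun y => ∑ a, gradForm g K u x y a •
    (EuclideanSpace.proj a : 𝔼 →L[ℝ] ℝ) with hη
  have hθ : ∀ a : Fin n, ContDiffOn ℝ ∞ (fun y => gradForm g K u x y a) B := fun a =>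
    (contDiffOn_gradForm g K hu x a).mono hB
  have hηs : ContDiffOn ℝ ∞ η B := ContDiffOn.sum fun a _ => (hθ a).smul contDiffOn_const
  have hηv : ∀ y (a : Fin n), η y (EuclideanSpace.single a 1) = gradForm g K u x y a := by
    intro y a
    simp [hη, _root_.sum_apply, _root_.smul_apply]
  have hsymm : ∀ y ∈ B, ∀ v w, fderiv ℝ η y v w = fderiv ℝ η y w v := by
    intro y hy v w
    have hd : ∀ a, DifferentiableAt ℝ (fun y => gradForm g K u x y a) y := fun a =>
      ((hθ a).contDiffAt (Metric.isOpen_ball.mem_nhds hy)).differentiableAt (by simp)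
    have hD : ∀ v w : 𝔼, fderiv ℝ η y v w
        = ∑ b, ∑ a, v b * w a * pd b (fun y => gradForm g K u x y a) y := by
      intro v w
      have h1 : HasFDerivAt η _ y := HasFDerivAt.fun_sum (u := Finset.univ) fun a _ =>
        (hd a).hasFDerivAt.smul_const (EuclideanSpace.proj a : 𝔼 →L[ℝ] ℝ)
      rw [h1.fderiv]
      simp only [_root_.sum_apply, ContinuousLinearMap.smulRight_apply, _root_.smul_apply,
        PiLp.proj_apply, smul_eq_mul, fderiv_apply_eq_sum_pd, Finset.sum_mul]
      rw [Finset.sum_comm]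
      exact Finset.sum_congr rfl fun _ _ => Finset.sum_congr rfl fun _ _ => by ring
    rw [hD, hD, Finset.sum_comm]
    refine Finset.sum_congr rfl fun a _ => Finset.sum_congr rfl fun b _ => ?_
    have := sub_eq_zero.1 (h x y (hB hy) a b)
    rw [this]; ring
  obtain ⟨F, hF⟩ := (convex_ball (extChartAt (𝓡 n) x x) r).exists_forall_hasFDerivAt_of_fderiv_symmetric
    Metric.isOpen_ball (hηs.differentiableOn (by simp)) hsymm
  have hFs : ContDiffOn ℝ ∞ F B := by
    rw [contDiffOn_infty_iff_fderiv_of_isOpen Metric.isOpen_ball]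
    exact ⟨fun y hy => (hF y hy).differentiableAt.differentiableWithinAt,
      hηs.congr fun y hy => (hF y hy).fderiv⟩
  have hUo : IsOpen ((extChartAt (𝓡 n) x).source ∩ extChartAt (𝓡 n) x ⁻¹' B) :=
    (continuousOn_extChartAt x).isOpen_inter_preimage (isOpen_extChartAt_source x)
      Metric.isOpen_ball
  set U := (extChartAt (𝓡 n) x).source ∩ extChartAt (𝓡 n) x ⁻¹' B with hU
  have hfs : ContMDiffOn (𝓡 n) 𝓘(ℝ, ℝ) ∞ (F ∘ extChartAt (𝓡 n) x) U := fun z hz =>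
    ((hFs.contDiffAt (Metric.isOpen_ball.mem_nhds hz.2)).contMDiffAt.comp z
      (contMDiffAt_extChart hz.1)).contMDiffWithinAt
  refine ⟨U, hUo, ⟨mem_extChartAt_source x, Metric.mem_ball_self hr⟩,
    F ∘ extChartAt (𝓡 n) x, ?_⟩
  have hcenter : ∀ y ∈ B, ∀ a : Fin n,
      pd a (fun z => (F ∘ extChartAt (𝓡 n) x) (chartInv x z)) y = gradForm g K u x y a := by
    intro y hy a
    have : (fun z => (F ∘ extChartAt (𝓡 n) x) (chartInv x z)) =ᶠ[nhds y] F :=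
      Filter.eventually_of_mem (Metric.isOpen_ball.mem_nhds hy) fun z hz => by
        simp only [Function.comp, extChartAt_chartInv (hB hz)]
    rw [pd_congr this, pd, (hF y hy).fderiv, hηv]
  rw [isPotentialOn_iff_tensorGrad_eq hfs]
  intro c y hy
  have hyx : y ∈ domOn c (extChartAt (𝓡 n) x).source := ⟨hy.1, hy.2.1⟩
  refine tensorGrad_eq_of_eq g.isTensorField K.isTensorField hUo hfs hu.contMDiffOn hyx hy.2 ?_
  have hτ : trans c x y ∈ B := hy.2.2
  have hdet := isUnit_det_cov g (hB hτ)
  have e2 : tensorGrad g.contra (F ∘ extChartAt (𝓡 n) x) x (trans c x y)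
      = (g.cov x (trans c x y))⁻¹.mulVec (gradForm g K u x (trans c x y)) := by
    rw [← funext (hcenter _ hτ)]; rfl
  have e1 : gradForm g K u x (trans c x y)
      = (g.cov x (trans c x y)).mulVec (tensorGrad K.contra u x (trans c x y)) := rfl
  rw [e2, e1, Matrix.mulVec_mulVec, Matrix.nonsing_inv_mul _ hdet, Matrix.one_mulVec]

end Commutator

/-! ### Gluing over a simply connected space -/

/-- On a simply connected, locally path connected space, functions `f i` on open sets `U i` which
differ by locally constant functions are glued, up to locally constant functions, to one function.
The germs of the functions `f i + const` form a covering space, a bundle with discrete fibre `A`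
whose transition functions are translations by the `f i - f j`; the glued function is a section. -/
theorem exists_glue_of_locally_const {X A : Type*} [TopologicalSpace X] [SimplyConnectedSpace X]
    [LocallyPathConnectedSpace X] [AddCommGroup A] (U : X → Set X) (hU : ∀ i, IsOpen (U i))
    (hxU : ∀ x, x ∈ U x) (f : X → X → A)
    (hf : ∀ i j, ∀ x ∈ U i ∩ U j, ∀ᶠ z in nhds x, f i z - f j z = f i x - f j x) :
    ∃ F : X → A, ∀ i, ∀ x ∈ U i, ∀ᶠ z in nhds x, F z - f i z = F x - f i x := by
  let _ : TopologicalSpace A := ⊥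
  have : DiscreteTopology A := ⟨rfl⟩
  let Z : FiberBundleCore X X A :=
    { baseSet := U
      isOpen_baseSet := hU
      indexAt := id
      mem_baseSet_at := hxU
      coordChange := fun i j x v => v + (f i x - f j x)
      coordChange_self := fun i x _ v => by simp
      continuousOn_coordChange := by
        rintro i j ⟨x, v⟩ hx
        have h1 : ContinuousAt (fun p : X × A => p.2 + (f i x - f j x)) (x, v) :=
          (continuous_of_discreteTopology (f := fun a : A => a + (f i x - f j x))).continuousAt.comp
            continuousAt_snd
        refine (h1.congr ?_).continuousWithinAt
        have h2 : ∀ᶠ p : X × A in nhds (x, v), f i p.1 - f j p.1 = f i x - f j x :=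
          (continuousAt_fst (p := (x, v))).eventually (hf i j x hx.1)
        exact h2.mono fun p hp => congrArg (p.2 + ·) hp.symm
      coordChange_comp := fun i j k x _ v => by rw [add_assoc, sub_add_sub_cancel] }
  have hcov : IsCoveringMap Z.proj := FiberBundle.isCoveringMap (F := A) (E := Z.Fiber)
  obtain ⟨x₀⟩ : Nonempty X := inferInstance
  obtain ⟨s, ⟨-, hs⟩, -⟩ := hcov.existsUnique_continuousMap_lifts (ContinuousMap.id X) x₀
    (⟨x₀, (0 : A)⟩ : Z.TotalSpace) rfl
  have hs1 : ∀ x, (s x).1 = x := fun x => congrFun hs x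
  refine ⟨fun x => (show A from (s x).2) + f x x, fun i x hx => ?_⟩
  -- the fibre coordinate of the section over `U i` is continuous into a discrete space
  have hv : ∀ z, (Z.localTriv i (s z)).2 = (show A from (s z).2) + f z z - f i z := by
    intro z
    rw [Z.localTriv_apply]
    change (show A from (s z).2) + (f (s z).1 (s z).1 - f i (s z).1) = _
    rw [hs1, add_sub_assoc]
  have hc : ContinuousAt (fun z => (Z.localTriv i (s z)).2) x := by
    have h1 : ContinuousAt (Z.localTriv i) (s x) :=
      (Z.localTriv i).continuousAt ((Z.mem_localTriv_source i (s x)).2 (by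
        rw [hs1]; exact hx))
    exact continuousAt_snd.comp (h1.comp s.continuous.continuousAt)
  have he := hc.eventually (isOpen_discrete ({(Z.localTriv i (s x)).2} : Set A) |>.mem_nhds rfl)
  filter_upwards [he] with z hz
  rw [← hv z, ← hv x]
  exact hz

/-! ### Global potentials and quantum corrections -/

section Potentials

variable {M : Type*} [TopologicalSpace M] [ChartedSpace (EuclideanSpace ℝ (Fin n)) M]

theorem isPotentialOn_univ_of_nhds {θ : M → 𝔼 → Fin n → ℝ} {F : M → ℝ}
    (h : ∀ x, ∃ U : Set M, IsOpen U ∧ x ∈ U ∧ IsPotentialOn F θ U) :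
    IsPotentialOn F θ Set.univ := by
  refine ⟨fun x _ => ?_, fun c y hy _ a => ?_⟩
  · obtain ⟨U, hU, hx, hF⟩ := h x
    exact (hF.1.contMDiffAt (hU.mem_nhds hx)).contMDiffWithinAt
  · obtain ⟨U, -, hx, hF⟩ := h (chartInv c y)
    exact hF.2 c y hy hx a

variable [IsManifold (𝓡 n) ∞ M]

/-- Two potentials of the same one-form differ by a locally constant function. -/
theorem eventually_sub_eq_of_isPotentialOn {θ : M → 𝔼 → Fin n → ℝ} {f u : M → ℝ} {U U' : Set M}
    (hU : IsOpen U) (hU' : IsOpen U') (hf : IsPotentialOn f θ U) (hu : IsPotentialOn u θ U')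
    {x : M} (hx : x ∈ U ∩ U') : ∀ᶠ z in nhds x, f z - u z = f x - u x := by
  have hUU := hU.inter hU'
  have hfs := hf.1.mono (Set.inter_subset_left (t := U'))
  have hus := hu.1.mono (Set.inter_subset_right (s := U))
  obtain ⟨r, hr, hB⟩ := Metric.isOpen_iff.1 (isOpen_domOn x hUU) _ (center_mem_domOn (n := n) hx)
  have hd : ∀ y ∈ Metric.ball (extChartAt (𝓡 n) x x) r,
      HasFDerivAt (fun z => f (chartInv x z) - u (chartInv x z)) (0 : 𝔼 →L[ℝ] ℝ) y := by
    intro y hy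
    have hf' := differentiableAt_rep hUU hfs (hB hy)
    have hu' := differentiableAt_rep hUU hus (hB hy)
    have h0 : fderiv ℝ (fun z => f (chartInv x z)) y = fderiv ℝ (fun z => u (chartInv x z)) y := by
      ext v
      rw [fderiv_apply_eq_sum_pd, fderiv_apply_eq_sum_pd]
      exact Finset.sum_congr rfl fun a _ => by
        rw [hf.2 x y (hB hy).1 (hB hy).2.1, hu.2 x y (hB hy).1 (hB hy).2.2]
    have := hf'.hasFDerivAt.sub hu'.hasFDerivAt
    rwa [h0, sub_self] at this
  have hconst : ∀ y ∈ Metric.ball (extChartAt (𝓡 n) x x) r,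
      f (chartInv x y) - u (chartInv x y) = f x - u x := by
    intro y hy
    have := (convex_ball (extChartAt (𝓡 n) x x) r).is_const_of_fderivWithin_eq_zero (𝕜 := ℝ)
      (fun z hz => (hd z hz).differentiableAt.differentiableWithinAt)
      (fun z hz => by
        rw [fderivWithin_of_isOpen Metric.isOpen_ball hz, (hd z hz).fderiv])
      hy (Metric.mem_ball_self hr)
    simpa only [chartInv_extChartAt (mem_extChartAt_source (I := 𝓡 n) x)] using this
  filter_upwards [extChartAt_source_mem_nhds (I := 𝓡 n) x,
    (continuousAt_extChartAt (I := 𝓡 n) x).eventually (Metric.ball_mem_nhds _ hr)] with z hz hzB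
  have := hconst _ hzB
  rwa [chartInv_extChartAt hz] at this

theorem IsPotentialOn.add_const {θ : M → 𝔼 → Fin n → ℝ} {f : M → ℝ} {U : Set M} (hU : IsOpen U)
    (h : IsPotentialOn f θ U) (r : ℝ) : IsPotentialOn (fun z => f z + r) θ U := by
  refine ⟨h.1.add contMDiffOn_const, fun c y hy hyU a => ?_⟩
  rw [pd_add (differentiableAt_rep hU h.1 ⟨hy, hyU⟩) (differentiableAt_const r), pd_const, add_zero,
    h.2 c y hy hyU a]

/-- On a simply connected manifold a locally exact one-form is exact. -/
theorem exists_isPotentialOn_univ [SimplyConnectedSpace M] {θ : M → 𝔼 → Fin n → ℝ}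
    (h : ∀ x : M, ∃ U : Set M, IsOpen U ∧ x ∈ U ∧ ∃ f : M → ℝ, IsPotentialOn f θ U) :
    ∃ F : M → ℝ, IsPotentialOn F θ Set.univ := by
  have : LocallyPathConnectedSpace M := ChartedSpace.locallyPathConnectedSpace 𝔼 M
  choose U hU hxU f hf using h
  obtain ⟨F, hF⟩ := exists_glue_of_locally_const U hU hxU f fun i j x hx =>
    eventually_sub_eq_of_isPotentialOn (hU i) (hU j) (hf i) (hf j) hx
  refine ⟨F, isPotentialOn_univ_of_nhds fun x => ?_⟩
  obtain ⟨O, hO, hOo, hxO⟩ := eventually_nhds_iff.1 (hF x x (hxU x))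
  have hp := (hf x).add_const (hU x) (F x - f x x)
  refine ⟨O ∩ U x, hOo.inter (hU x), ⟨hxO, hxU x⟩, isPotentialOn_congr (hOo.inter (hU x))
    (f := fun z => f x z + (F x - f x x)) ⟨hp.1.mono Set.inter_subset_right,
      fun c y hy hyU a => hp.2 c y hy hyU.2 a⟩ fun z hz => ?_⟩
  simp only [← hO z hz.1, add_sub_cancel]

/-- The corrections of `K` that go with `E` are the sums of `F₀` and a potential of
`K∇(E - E₀)`. -/
theorem quantumCommuteOn_iff_exists_isPotentialOn [T2Space M] {hbar : ℝ} (hbar_ne : hbar ≠ 0)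
    {g : PseudoRiemannianMetric n M}
    {V E₀ E : M → ℝ} {K : SymTwoTensor n M} {VK F₀ W : M → ℝ}
    (hV : ContMDiff (𝓡 n) 𝓘(ℝ, ℝ) ∞ V) (hVK : ContMDiff (𝓡 n) 𝓘(ℝ, ℝ) ∞ VK)
    (hE₀ : ContMDiff (𝓡 n) 𝓘(ℝ, ℝ) ∞ E₀) (hE : ContMDiff (𝓡 n) 𝓘(ℝ, ℝ) ∞ E)
    (hF₀ : ContMDiff (𝓡 n) 𝓘(ℝ, ℝ) ∞ F₀)
    (h : QuantumCommuteOn hbar g V E₀ K VK F₀ Set.univ) {U : Set M} (hU : IsOpen U)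
    (hW : ContMDiffOn (𝓡 n) 𝓘(ℝ, ℝ) ∞ W U) :
    QuantumCommuteOn hbar g V E K VK W U ↔ ∃ Fbar : M → ℝ,
      IsPotentialOn Fbar (gradForm g K (fun x => E x - E₀ x)) U ∧
        ∀ x ∈ U, W x = F₀ x + Fbar x := by
  have hWF : ContMDiffOn (𝓡 n) 𝓘(ℝ, ℝ) ∞ (fun x => W x - F₀ x) U := hW.sub hF₀.contMDiffOn
  rw [quantumCommuteOn_iff_tensorGrad_eq hbar_ne hU hV.contMDiffOn hVK.contMDiffOn hE₀.contMDiffOn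
    hE.contMDiffOn hF₀.contMDiffOn hW (h.mono hU), ← isPotentialOn_iff_tensorGrad_eq hWF]
  constructor
  · exact fun hp => ⟨_, hp, fun x _ => by ring⟩
  · rintro ⟨Fbar, hp, hWx⟩
    exact isPotentialOn_congr hU hp fun x hx => by simp only [hWx x hx, add_sub_cancel_left]

end Potentials

end MLB

end

theorem theorem2 {n : ℕ} {M : Type*} [TopologicalSpace M] [T2Space M]
    [ChartedSpace (EuclideanSpace ℝ (Fin n)) M] [IsManifold (𝓡 n) ∞ M]
    (hbar : ℝ) (hbar_ne : hbar ≠ 0)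
    (g : MLB.PseudoRiemannianMetric n M)
    (V : M → ℝ) (hV : ContMDiff (𝓡 n) 𝓘(ℝ, ℝ) ∞ V)
    {k : ℕ} (K : Fin k → MLB.SymTwoTensor n M)
    (VK : Fin k → M → ℝ) (hVK : ∀ i, ContMDiff (𝓡 n) 𝓘(ℝ, ℝ) ∞ (VK i))
    (hK : ∀ i, MLB.IsFirstIntegral g V (K i) (VK i))
    (E₀ F₀ : Fin k → M → ℝ)
    (hE₀ : ∀ i, ContMDiff (𝓡 n) 𝓘(ℝ, ℝ) ∞ (E₀ i))
    (hF₀ : ∀ i, ContMDiff (𝓡 n) 𝓘(ℝ, ℝ) ∞ (F₀ i))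
    (hcomm : ∀ i, MLB.QuantumCommuteOn hbar g V (E₀ i) (K i) (VK i) (F₀ i) Set.univ)
    (E : M → ℝ) (hE : ContMDiff (𝓡 n) 𝓘(ℝ, ℝ) ∞ E) :
    -- `E` is a simultaneous correction near every point
    ((∀ x : M, ∃ U : Set M, IsOpen U ∧ x ∈ U ∧
        ∃ W : Fin k → M → ℝ, MLB.IsSimultaneousOn hbar g V E K VK W U) ↔
      ∀ i, MLB.SameExtD (MLB.gradForm g (K i) (E₀ i)) (MLB.gradForm g (K i) E)) ∧
    -- on a simply connected manifold, `E` is a simultaneous correction globally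
    (SimplyConnectedSpace M →
      ((∃ W : Fin k → M → ℝ, MLB.IsSimultaneousOn hbar g V E K VK W Set.univ) ↔
        ∀ i, MLB.SameExtD (MLB.gradForm g (K i) (E₀ i)) (MLB.gradForm g (K i) E))) ∧
    -- when the condition holds, the one-forms `K^(i)∇(E - E^(i))` are closed
    (∀ i, MLB.SameExtD (MLB.gradForm g (K i) (E₀ i)) (MLB.gradForm g (K i) E) →
      MLB.IsClosedForm (MLB.gradForm g (K i) (fun x => E x - E₀ i x))) ∧
    -- the corrections of `K^(i)` that go with `E` are `F^(i)` plus the potentials of that one-form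
    (∀ U : Set M, IsOpen U → ∀ (i : Fin k) (W : M → ℝ), ContMDiffOn (𝓡 n) 𝓘(ℝ, ℝ) ∞ W U →
      (MLB.QuantumCommuteOn hbar g V E (K i) (VK i) W U ↔
        ∃ Fbar : M → ℝ,
          MLB.IsPotentialOn Fbar (MLB.gradForm g (K i) (fun x => E x - E₀ i x)) U ∧
          ∀ x ∈ U, W x = F₀ i x + Fbar x)) := by
  have hiff : ∀ {U : Set M}, IsOpen U → ∀ (i : Fin k) {W : M → ℝ},
      ContMDiffOn (𝓡 n) 𝓘(ℝ, ℝ) ∞ W U →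
      (MLB.QuantumCommuteOn hbar g V E (K i) (VK i) W U ↔ ∃ Fbar : M → ℝ,
        MLB.IsPotentialOn Fbar (MLB.gradForm g (K i) (fun x => E x - E₀ i x)) U ∧
        ∀ x ∈ U, W x = F₀ i x + Fbar x) := fun hU i _ hW =>
    MLB.quantumCommuteOn_iff_exists_isPotentialOn hbar_ne hV (hVK i) (hE₀ i) hE (hF₀ i) (hcomm i)
      hU hW
  have hclosed := fun i => MLB.sameExtD_iff_isClosedForm g (K i) hE (hE₀ i)
  have hpot : ∀ {U : Set M}, IsOpen U → ∀ f : Fin k → M → ℝ,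
      (∀ i, MLB.IsPotentialOn (f i) (MLB.gradForm g (K i) (fun x => E x - E₀ i x)) U) →
      MLB.IsSimultaneousOn hbar g V E K VK (fun i x => F₀ i x + f i x) U := by
    intro U hU f hf i
    have hW := (hF₀ i).contMDiffOn.add (hf i).1
    exact ⟨hW, (hiff hU i hW).2 ⟨f i, hf i, fun _ _ => rfl⟩⟩
  have hlocal : (∀ x : M, ∃ U : Set M, IsOpen U ∧ x ∈ U ∧
        ∃ W : Fin k → M → ℝ, MLB.IsSimultaneousOn hbar g V E K VK W U) →
      ∀ i, MLB.SameExtD (MLB.gradForm g (K i) (E₀ i)) (MLB.gradForm g (K i) E) := by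
    intro h i
    rw [hclosed]
    intro c y hy a b
    obtain ⟨U, hU, hx, W, hW⟩ := h (MLB.chartInv c y)
    obtain ⟨f, hf, -⟩ := (hiff hU i (hW i).1).1 (hW i).2
    exact MLB.extD_eq_zero_of_isPotentialOn hU hf ⟨hy, hx⟩ a b
  have hexact : (∀ i, MLB.SameExtD (MLB.gradForm g (K i) (E₀ i)) (MLB.gradForm g (K i) E)) →
      ∀ i (x : M), ∃ U : Set M, IsOpen U ∧ x ∈ U ∧ ∃ f : M → ℝ,
        MLB.IsPotentialOn f (MLB.gradForm g (K i) (fun x => E x - E₀ i x)) U := fun h i x =>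
    MLB.exists_isPotentialOn_nhds g (K i) (hE.sub (hE₀ i)) ((hclosed i).1 (h i)) x
  refine ⟨⟨hlocal, fun h x => ?_⟩, fun _ => ⟨?_, fun h => ?_⟩, fun i => (hclosed i).1,
    fun U hU i W hW => hiff hU i hW⟩
  · choose U hU hx f hf using fun i => hexact h i x
    refine ⟨⋂ i, U i, isOpen_iInter_of_finite hU, Set.mem_iInter.2 hx, _,
      hpot (isOpen_iInter_of_finite hU) f fun i => ?_⟩
    exact ⟨(hf i).1.mono (Set.iInter_subset U i),
      fun c y hy hyU a => (hf i).2 c y hy (Set.mem_iInter.1 hyU i) a⟩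
  · rintro ⟨W, hW⟩
    exact hlocal fun x => ⟨Set.univ, isOpen_univ, trivial, W, hW⟩
  · choose f hf using fun i => MLB.exists_isPotentialOn_univ (hexact h i)
    exact ⟨_, hpot isOpen_univ f hf⟩
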